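/- Let $\mathbb T$ be the unit circle with its normalized measure, and for a function $f$ on $\mathbb T$ let $\frac{d}{dt}f(t)=\lim_{r\to0}\frac{f(e^{2\pi i r}t)-f(t)}{r}$. Let $C^\infty(\mathbb T)$ be the $*$-algebra of smooth functions on $\mathbb T$ with the seminorms $\|f\|_k=\sup_{t}|f^{(k)}(t)|$, $k\ge 0$. Let $H^2$ be the Hardy space, the closed linear span of the functions $t^n$, $n\ge 0$, in $L^2(\mathbb T)$. Let $\mathcal K^\infty$ be the $*$-algebra of the compact operators $S$ on $H^2$ for which there is $K\in C^\infty(\mathbb T^2)$ with $(S\xi)(t)=\int_{\mathbb T}K(t,s)\,\xi(s)\,ds$ for all $\xi\in H^2$. Let $K_S$ be the unique such kernel whose Fourier series contains only the functions $t^k s^{-l}$ with $k,l\ge 0$, and equip $\mathcal K^\infty$ with the seminorms $\|S\|_{l,m}=\sup_{t,s}\left|\frac{\partial^{l+m}K_S}{\partial t^l\,\partial s^m}(t,s)\right|$, $l,m\ge 0$. For $\theta\in\mathbb R$ let $U_\theta$ be the unitary operator $(U_\theta\xi)(t)=\xi(e^{2\pi i\theta}t)$ on $H^2$, and let $\alpha_\theta(S)=U_\theta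 SU_\theta^*$ be the gauge automorphism of $\mathcal K^\infty$. The crossed product $\mathcal K^\infty\rtimes_{\alpha_\theta}\mathbb Z$ is the completion of the $*$-algebra of formal finite sums $\sum_{n\in\mathbb Z}A_nU_\theta^n$, $A_n\in\mathcal K^\infty$, with $$(AU_\theta^m)(BU_\theta^n)=A\,\alpha_\theta^m(B)\,U_\theta^{m+n},\qquad (AU_\theta^n)^*=\alpha_\theta^{-n}(A^*)\,U_\theta^{-n},$$ for the seminorms $\sup_{n\in\mathbb Z}(1+|n|^2)^p\,\|A_n\|_{l,m}$, $p,l,m\ge 0$. Let $\mathcal K^\infty\hat\otimes_\gamma C^\infty(\mathbb T)$ be the completed projective tensor product, that is, the completion of the algebraic tensor product, with $(a\otimes b)(c\otimes d)=ac\otimes bd$ and $(a\otimes b)^*=a^*\otimes b^*$, for the seminorms $$\|x\|_{N,M}=\inf\Big\{\sum_{j}\ \max_{l,m\le N}\|a_j\|_{l,m}\cdot\max_{k\le M}\|b_j\|_k\ :\ x=\sum_j a_j\otimes b_j\Big\},\qquad N,M\ge 0.$$ Then for every $\theta\in\mathbb R$ there is an isomorphism $$\mathcal K^\infty\rtimes_{\alpha_\theta}\mathbb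 Z\;\simeq\;\mathcal K^\infty\,\hat\otimes_\gamma\,C^\infty(\mathbb T)$$ of Fréchet $*$-algebras, i.e. a bijective $\mathbb C$-linear map that preserves products and involutions and is a homeomorphism. -/

import Mathlib

noncomputable section

open MeasureTheory AddCircle Filter Topology ComplexConjugate
open scoped ContDiff TensorProduct InnerProductSpace

namespace SmoothCompacts

/-! ### Smooth functions on the circle and on the torus -/

/-- The circle `T`, identified with `ℝ / ℤ` through `r ↦ exp (2 π i r)`. Under this identification
the function `t ↦ t ^ n` is `fourier n`, and the normalized measure is `haarAddCircle`. -/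
abbrev Torus1 : Type := UnitAddCircle

/-- The derivative `(d/dt) f (t) = lim_{r → 0} (f (exp (2 π i r) t) - f t) / r`. -/
def circleDeriv (f : Torus1 → ℂ) : Torus1 → ℂ :=
  fun t => deriv (fun r : ℝ => f (t + (r : Torus1))) 0

/-- Infinitely differentiable functions on `T`. -/
def IsSmooth1 (f : Torus1 → ℂ) : Prop :=
  ContDiff ℝ ∞ (fun x : ℝ => f (x : Torus1))

/-- Infinitely differentiable functions on `T × T`. -/
def IsSmooth2 (K : Torus1 × Torus1 → ℂ) : Prop :=
  ContDiff ℝ ∞ (fun x : ℝ × ℝ => K ((x.1 : Torus1), (x.2 : Torus1)))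

/-- `∂/∂t` of a function of `(t, s)`. -/
def pderivFst (K : Torus1 × Torus1 → ℂ) : Torus1 × Torus1 → ℂ :=
  fun p => circleDeriv (fun t => K (t, p.2)) p.1

/-- `∂/∂s` of a function of `(t, s)`. -/
def pderivSnd (K : Torus1 × Torus1 → ℂ) : Torus1 × Torus1 → ℂ :=
  fun p => circleDeriv (fun s => K (p.1, s)) p.2

theorem circleDeriv_coe (f : Torus1 → ℂ) (x : ℝ) :
    circleDeriv f (x : Torus1) = deriv (fun y : ℝ => f (y : Torus1)) x := by
  have h : (fun r : ℝ => f ((x : Torus1) + (r : Torus1))) =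
      fun r : ℝ => (fun y : ℝ => f (y : Torus1)) (x + r) := by
    funext r; simp
  rw [circleDeriv, h, deriv_comp_const_add (f := fun y : ℝ => f (y : Torus1))]
  simp

theorem IsSmooth1.circleDeriv {f : Torus1 → ℂ} (hf : IsSmooth1 f) :
    IsSmooth1 (circleDeriv f) := by
  have h : (fun x : ℝ => SmoothCompacts.circleDeriv f (x : Torus1)) =
      deriv (fun y : ℝ => f (y : Torus1)) := by
    funext x; exact circleDeriv_coe f x
  rw [IsSmooth1, h]
  exact (contDiff_infty_iff_deriv.1 hf).2

theorem IsSmooth1.iterate {f : Torus1 → ℂ} (hf : IsSmooth1 f) (k : ℕ) :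
    IsSmooth1 (SmoothCompacts.circleDeriv^[k] f) := by
  induction k with
  | zero => exact hf
  | succ k ih => rw [Function.iterate_succ_apply']; exact ih.circleDeriv

theorem IsSmooth1.continuous {f : Torus1 → ℂ} (hf : IsSmooth1 f) : Continuous f := by
  have : Continuous (fun x : ℝ => f (x : Torus1)) := ContDiff.continuous hf
  exact continuous_coinduced_dom.2 this

theorem IsSmooth1.hasDerivAt {f : Torus1 → ℂ} (hf : IsSmooth1 f) (x : ℝ) :
    HasDerivAt (fun y : ℝ => f (y : Torus1)) (SmoothCompacts.circleDeriv f (x : Torus1)) x := by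
  rw [circleDeriv_coe]
  exact (ContDiff.differentiable hf (by simp)).differentiableAt.hasDerivAt

theorem circleDeriv_eq {f g : Torus1 → ℂ}
    (h : ∀ x : ℝ, HasDerivAt (fun y : ℝ => f (y : Torus1)) (g (x : Torus1)) x) :
    circleDeriv f = g := by
  funext t
  induction t using QuotientAddGroup.induction_on with
  | H x => exact (circleDeriv_coe f x).trans (h x).deriv

theorem isSmooth2_continuous {K : Torus1 × Torus1 → ℂ} (hK : IsSmooth2 K) : Continuous K := by
  have h : Continuous (fun x : ℝ × ℝ => K ((x.1 : Torus1), (x.2 : Torus1))) :=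
    ContDiff.continuous hK
  have q : IsOpenQuotientMap (Prod.map (fun x : ℝ => (x : Torus1)) (fun x : ℝ => (x : Torus1))) :=
    (QuotientAddGroup.isOpenQuotientMap_mk).prodMap QuotientAddGroup.isOpenQuotientMap_mk
  exact q.isQuotientMap.continuous_iff.2 h

theorem IsSmooth2.fst {K : Torus1 × Torus1 → ℂ} (hK : IsSmooth2 K) (s : Torus1) :
    IsSmooth1 (fun t => K (t, s)) := by
  induction s using QuotientAddGroup.induction_on with
  | H y => exact ContDiff.comp (g := fun x : ℝ × ℝ => K ((x.1 : Torus1), (x.2 : Torus1))) hK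
            (f := fun x : ℝ => (x, y)) (by fun_prop)

theorem IsSmooth2.snd {K : Torus1 × Torus1 → ℂ} (hK : IsSmooth2 K) (t : Torus1) :
    IsSmooth1 (fun s => K (t, s)) := by
  induction t using QuotientAddGroup.induction_on with
  | H y => exact ContDiff.comp (g := fun x : ℝ × ℝ => K ((x.1 : Torus1), (x.2 : Torus1))) hK
            (f := fun x : ℝ => (y, x)) (by fun_prop)

theorem IsSmooth2.pderivFst {K : Torus1 × Torus1 → ℂ} (hK : IsSmooth2 K) :
    IsSmooth2 (pderivFst K) := by
  set F : ℝ × ℝ → ℂ := fun x => K ((x.1 : Torus1), (x.2 : Torus1)) with hF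
  have h : (fun x : ℝ × ℝ => SmoothCompacts.pderivFst K ((x.1 : Torus1), (x.2 : Torus1))) =
      fun x => fderiv ℝ F x (1, 0) := by
    funext x
    have h1 : HasFDerivAt F (fderiv ℝ F x) (x.1, x.2) :=
      (ContDiff.differentiable hK (by simp)).differentiableAt.hasFDerivAt
    have h2 : HasDerivAt (fun r : ℝ => (r, x.2)) ((1 : ℝ), (0 : ℝ)) x.1 :=
      (hasDerivAt_id _).prodMk (hasDerivAt_const _ _)
    refine (circleDeriv_coe _ _).trans ?_
    exact (HasFDerivAt.comp_hasDerivAt (f := fun r : ℝ => (r, x.2)) x.1 h1 h2).deriv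
  rw [IsSmooth2, h]
  exact ((contDiff_infty_iff_fderiv.1 hK).2).clm_apply contDiff_const

theorem IsSmooth2.pderivSnd {K : Torus1 × Torus1 → ℂ} (hK : IsSmooth2 K) :
    IsSmooth2 (pderivSnd K) := by
  set F : ℝ × ℝ → ℂ := fun x => K ((x.1 : Torus1), (x.2 : Torus1)) with hF
  have h : (fun x : ℝ × ℝ => SmoothCompacts.pderivSnd K ((x.1 : Torus1), (x.2 : Torus1))) =
      fun x => fderiv ℝ F x (0, 1) := by
    funext x
    have h1 : HasFDerivAt F (fderiv ℝ F x) (x.1, x.2) :=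
      (ContDiff.differentiable hK (by simp)).differentiableAt.hasFDerivAt
    have h2 : HasDerivAt (fun r : ℝ => (x.1, r)) ((0 : ℝ), (1 : ℝ)) x.2 :=
      (hasDerivAt_const _ _).prodMk (hasDerivAt_id _)
    refine (circleDeriv_coe _ _).trans ?_
    exact (HasFDerivAt.comp_hasDerivAt (f := fun r : ℝ => (x.1, r)) x.2 h1 h2).deriv
  rw [IsSmooth2, h]
  exact ((contDiff_infty_iff_fderiv.1 hK).2).clm_apply contDiff_const

theorem IsSmooth2.iterate {K : Torus1 × Torus1 → ℂ} (hK : IsSmooth2 K) (l m : ℕ) :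
    IsSmooth2 (SmoothCompacts.pderivFst^[l] (SmoothCompacts.pderivSnd^[m] K)) := by
  have h : IsSmooth2 (SmoothCompacts.pderivSnd^[m] K) := by
    induction m with
    | zero => exact hK
    | succ k ih => rw [Function.iterate_succ_apply']; exact ih.pderivSnd
  induction l with
  | zero => exact h
  | succ k ih => rw [Function.iterate_succ_apply']; exact ih.pderivFst

theorem bddAbove_norm {X : Type*} [TopologicalSpace X] [CompactSpace X] {f : X → ℂ}
    (hf : Continuous f) : BddAbove (Set.range fun x => ‖f x‖) := by
  simpa using (isCompact_univ.image hf.norm).bddAbove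

/-! ### Fourier coefficients of smooth functions -/

theorem norm_fourier (n : ℤ) (t : Torus1) : ‖fourier n t‖ = 1 := by
  rw [fourier_apply]; exact Circle.norm_coe _

theorem integral_circleDeriv {f : Torus1 → ℂ} (hf : IsSmooth1 f) :
    ∫ t, circleDeriv f t ∂haarAddCircle = 0 := by
  rw [integral_haarAddCircle, ← AddCircle.intervalIntegral_preimage 1 0]
  rw [intervalIntegral.integral_eq_sub_of_hasDerivAt (fun x _ => hf.hasDerivAt x)]
  · rw [zero_add, show ((1 : ℝ) : Torus1) = 0 from AddCircle.coe_period 1]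
    simp
  · exact (ContDiff.continuous hf.circleDeriv).intervalIntegrable _ _

theorem isSmooth1_fourier (n : ℤ) : IsSmooth1 (fun t => fourier n t) := by
  have : (fun x : ℝ => fourier n (x : Torus1)) =
      fun x : ℝ => Complex.exp (2 * Real.pi * Complex.I * n * x) := by
    funext x; rw [fourier_coe_apply]; simp
  rw [IsSmooth1, this]
  exact Complex.contDiff_exp.comp (contDiff_const.mul Complex.ofRealCLM.contDiff)

theorem hasDerivAt_fourier' (n : ℤ) (x : ℝ) :
    HasDerivAt (fun y : ℝ => fourier n (y : Torus1))
      (2 * Real.pi * Complex.I * n * fourier n (x : Torus1)) x := by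
  simpa using hasDerivAt_fourier 1 n x

theorem fourierCoeff_circleDeriv {f : Torus1 → ℂ} (hf : IsSmooth1 f) (n : ℤ) :
    fourierCoeff (circleDeriv f) n = 2 * Real.pi * Complex.I * n * fourierCoeff f n := by
  have hs : IsSmooth1 (fun t => fourier (-n) t * f t) := ContDiff.mul (isSmooth1_fourier (-n)) hf
  have h0 := integral_circleDeriv hs
  have h1 : circleDeriv (fun t => fourier (-n) t * f t) =
      fun t => -(2 * Real.pi * Complex.I * n) * (fourier (-n) t * f t) +
        fourier (-n) t * circleDeriv f t := by
    apply circleDeriv_eq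
    intro x
    refine ((hasDerivAt_fourier' (-n) x).mul (hf.hasDerivAt x)).congr_deriv ?_
    push_cast; ring
  have c1 : Continuous f := hf.continuous
  have c2 : Continuous (circleDeriv f) := hf.circleDeriv.continuous
  have c3 : Continuous (fun t : Torus1 => fourier (-n) t) := (fourier (-n)).continuous
  rw [h1, integral_add, integral_const_mul] at h0
  · simp only [fourierCoeff, smul_eq_mul]
    linear_combination h0
  · exact ((continuous_const.mul (c3.mul c1)).integrable_of_hasCompactSupport
      (HasCompactSupport.of_compactSpace _))
  · exact ((c3.mul c2).integrable_of_hasCompactSupport (HasCompactSupport.of_compactSpace _))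

theorem fourierCoeff_iterate {f : Torus1 → ℂ} (hf : IsSmooth1 f) (n : ℤ) (p : ℕ) :
    fourierCoeff (circleDeriv^[p] f) n =
      (2 * Real.pi * Complex.I * n) ^ p * fourierCoeff f n := by
  induction p with
  | zero => simp
  | succ p ih =>
    rw [Function.iterate_succ_apply', fourierCoeff_circleDeriv (hf.iterate p), ih]; ring

theorem norm_fourierCoeff_le {f : Torus1 → ℂ} {C : ℝ} (hC : ∀ t, ‖f t‖ ≤ C) (n : ℤ) :
    ‖fourierCoeff f n‖ ≤ C := by
  have := norm_integral_le_of_norm_le_const (μ := (haarAddCircle : Measure Torus1))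
    (f := fun t => fourier (-n) t • f t) (C := C)
    (Eventually.of_forall fun t => by rw [norm_smul, norm_fourier, one_mul]; exact hC t)
  simpa [fourierCoeff] using this

theorem pow_mul_norm_fourierCoeff_le {f : Torus1 → ℂ} (hf : IsSmooth1 f) {C : ℝ} {p : ℕ}
    (hC : ∀ t, ‖circleDeriv^[p] f t‖ ≤ C) (n : ℤ) :
    |(n : ℝ)| ^ p * ‖fourierCoeff f n‖ ≤ C := by
  have h := norm_fourierCoeff_le hC n
  rw [fourierCoeff_iterate hf, norm_mul, norm_pow] at h
  refine le_trans ?_ h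
  gcongr
  simp only [norm_mul, Complex.norm_ofNat, Complex.norm_real, Complex.norm_I, Complex.norm_intCast,
    Real.norm_eq_abs, mul_one]
  have : 1 ≤ 2 * |Real.pi| := by rw [abs_of_pos Real.pi_pos]; linarith [Real.pi_gt_three]
  nlinarith [abs_nonneg (n : ℝ)]

/-! ### Rapidly decreasing matrices and their generating series -/

/-- Rapidly decreasing infinite matrices. -/
def RapidDecay (c : ℕ × ℕ → ℂ) : Prop :=
  ∀ p : ℕ, Summable fun i : ℕ × ℕ => (1 + (i.1 : ℝ) + i.2) ^ p * ‖c i‖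

/-- The function `∑ c (k, l) t ^ k s ^ (-l)` on the torus. -/
def kernelSeries (c : ℕ × ℕ → ℂ) : Torus1 × Torus1 → ℂ :=
  fun p => ∑' i : ℕ × ℕ, c i * (fourier (i.1 : ℤ) p.1 * fourier (-(i.2 : ℤ)) p.2)

theorem one_le_weight (i : ℕ × ℕ) : 1 ≤ 1 + (i.1 : ℝ) + i.2 := by
  have h1 : (0 : ℝ) ≤ i.1 := Nat.cast_nonneg _
  have h2 : (0 : ℝ) ≤ i.2 := Nat.cast_nonneg _
  linarith

theorem RapidDecay.summable {c : ℕ × ℕ → ℂ} (hc : RapidDecay c) : Summable fun i => ‖c i‖ := by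
  simpa using hc 0

theorem RapidDecay.of_le {c d : ℕ × ℕ → ℂ} (hc : RapidDecay c) (q : ℕ) (C : ℝ)
    (h : ∀ i, ‖d i‖ ≤ C * ((1 + (i.1 : ℝ) + i.2) ^ q * ‖c i‖)) : RapidDecay d := by
  intro p
  refine Summable.of_nonneg_of_le (fun i => ?_) (fun i => ?_) ((hc (p + q)).mul_left C)
  · have := one_le_weight i; positivity
  · have := one_le_weight i
    calc (1 + (i.1 : ℝ) + i.2) ^ p * ‖d i‖
        ≤ (1 + (i.1 : ℝ) + i.2) ^ p * (C * ((1 + (i.1 : ℝ) + i.2) ^ q * ‖c i‖)) := by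
          gcongr; exact h i
      _ = C * ((1 + (i.1 : ℝ) + i.2) ^ (p + q) * ‖c i‖) := by rw [pow_add]; ring

theorem RapidDecay.add {c d : ℕ × ℕ → ℂ} (hc : RapidDecay c) (hd : RapidDecay d) :
    RapidDecay (c + d) := by
  intro p
  refine Summable.of_nonneg_of_le (fun i => ?_) (fun i => ?_) ((hc p).add (hd p))
  · have := one_le_weight i; positivity
  · have := one_le_weight i
    rw [← mul_add, Pi.add_apply]
    gcongr
    exact norm_add_le _ _

/-- The matrix of `∂/∂t` of the generating series. -/
def dFst (c : ℕ × ℕ → ℂ) : ℕ × ℕ → ℂ := fun i => 2 * Real.pi * Complex.I * i.1 * c i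

/-- The matrix of `∂/∂s` of the generating series. -/
def dSnd (c : ℕ × ℕ → ℂ) : ℕ × ℕ → ℂ := fun i => -(2 * Real.pi * Complex.I * i.2) * c i

theorem RapidDecay.dFst {c : ℕ × ℕ → ℂ} (hc : RapidDecay c) : RapidDecay (dFst c) := by
  refine hc.of_le 1 (2 * Real.pi) fun i => ?_
  simp only [SmoothCompacts.dFst, norm_mul, Complex.norm_ofNat, Complex.norm_real, Complex.norm_I,
    Complex.norm_natCast, Real.norm_eq_abs, abs_of_pos Real.pi_pos, mul_one, pow_one]
  have h2 : (0 : ℝ) ≤ i.2 := Nat.cast_nonneg _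
  rw [mul_assoc]
  have := Real.pi_pos
  gcongr
  linarith

theorem RapidDecay.dSnd {c : ℕ × ℕ → ℂ} (hc : RapidDecay c) : RapidDecay (dSnd c) := by
  refine hc.of_le 1 (2 * Real.pi) fun i => ?_
  simp only [SmoothCompacts.dSnd, norm_neg, norm_mul, Complex.norm_ofNat, Complex.norm_real,
    Complex.norm_I, Complex.norm_natCast, Real.norm_eq_abs, abs_of_pos Real.pi_pos, mul_one,
    pow_one]
  have h2 : (0 : ℝ) ≤ i.1 := Nat.cast_nonneg _
  rw [mul_assoc]
  have := Real.pi_pos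
  gcongr
  linarith

theorem norm_term (c : ℕ × ℕ → ℂ) (i : ℕ × ℕ) (p : Torus1 × Torus1) :
    ‖c i * (fourier (i.1 : ℤ) p.1 * fourier (-(i.2 : ℤ)) p.2)‖ = ‖c i‖ := by
  rw [norm_mul, norm_mul, norm_fourier, norm_fourier]; simp

theorem RapidDecay.summable_term {c : ℕ × ℕ → ℂ} (hc : RapidDecay c) (p : Torus1 × Torus1) :
    Summable fun i : ℕ × ℕ => c i * (fourier (i.1 : ℤ) p.1 * fourier (-(i.2 : ℤ)) p.2) :=
  Summable.of_norm (by simpa only [norm_term] using hc.summable)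

theorem norm_kernelSeries_le {c : ℕ × ℕ → ℂ} (hc : RapidDecay c) (p : Torus1 × Torus1) :
    ‖kernelSeries c p‖ ≤ ∑' i, ‖c i‖ := by
  refine (norm_tsum_le_tsum_norm ?_).trans_eq ?_
  · simpa only [norm_term] using hc.summable
  · simp only [norm_term]

theorem hasFDerivAt_kernelSeries {c : ℕ × ℕ → ℂ} (hc : RapidDecay c) (x : ℝ × ℝ) :
    HasFDerivAt (fun y : ℝ × ℝ => kernelSeries c ((y.1 : Torus1), (y.2 : Torus1)))
      ((ContinuousLinearMap.fst ℝ ℝ ℝ).smulRight (kernelSeries (dFst c) (x.1, x.2)) +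
        (ContinuousLinearMap.snd ℝ ℝ ℝ).smulRight (kernelSeries (dSnd c) (x.1, x.2))) x := by
  set f' : ℕ × ℕ → ℝ × ℝ → (ℝ × ℝ →L[ℝ] ℂ) := fun i y =>
    (ContinuousLinearMap.fst ℝ ℝ ℝ).smulRight
      (dFst c i * (fourier (i.1 : ℤ) (y.1 : Torus1) * fourier (-(i.2 : ℤ)) (y.2 : Torus1))) +
    (ContinuousLinearMap.snd ℝ ℝ ℝ).smulRight
      (dSnd c i * (fourier (i.1 : ℤ) (y.1 : Torus1) * fourier (-(i.2 : ℤ)) (y.2 : Torus1)))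
    with hf'
  have hb : ∀ i y, ‖f' i y‖ ≤ ‖dFst c i‖ + ‖dSnd c i‖ := by
    intro i y
    refine (norm_add_le _ _).trans (add_le_add ?_ ?_)
    · rw [ContinuousLinearMap.norm_smulRight_apply, norm_term (dFst c) i (y.1, y.2)]
      exact mul_le_of_le_one_left (norm_nonneg _) (ContinuousLinearMap.norm_fst_le ℝ ℝ ℝ)
    · rw [ContinuousLinearMap.norm_smulRight_apply, norm_term (dSnd c) i (y.1, y.2)]
      exact mul_le_of_le_one_left (norm_nonneg _) (ContinuousLinearMap.norm_snd_le ℝ ℝ ℝ)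
  have hsum : Summable fun i => ‖dFst c i‖ + ‖dSnd c i‖ :=
    hc.dFst.summable.add hc.dSnd.summable
  have key := hasFDerivAt_tsum (𝕜 := ℝ)
    (f := fun (i : ℕ × ℕ) (y : ℝ × ℝ) =>
      c i * (fourier (i.1 : ℤ) (y.1 : Torus1) * fourier (-(i.2 : ℤ)) (y.2 : Torus1)))
    (f' := f') (x₀ := 0) hsum ?_ hb (by exact hc.summable_term ((0 : ℝ), (0 : ℝ))) x
  · refine key.congr_fderiv ?_
    have s1 := hc.dFst.summable_term ((x.1 : Torus1), (x.2 : Torus1))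
    have s2 := hc.dSnd.summable_term ((x.1 : Torus1), (x.2 : Torus1))
    have hs : Summable fun i => f' i x := Summable.of_norm_bounded hsum (fun i => hb i x)
    refine ContinuousLinearMap.ext fun v => ?_
    have h0 := (ContinuousLinearMap.apply ℝ ℂ v).map_tsum hs
    simp only [ContinuousLinearMap.apply_apply] at h0
    rw [h0]
    simp only [hf', _root_.add_apply, ContinuousLinearMap.smulRight_apply,
      ContinuousLinearMap.coe_fst', ContinuousLinearMap.coe_snd', kernelSeries]
    rw [Summable.tsum_add (s1.const_smul v.1) (s2.const_smul v.2), tsum_const_smul'',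
      tsum_const_smul'']
  · intro i y
    have h1 : HasFDerivAt (fun y : ℝ × ℝ => fourier (i.1 : ℤ) (y.1 : Torus1))
        ((ContinuousLinearMap.fst ℝ ℝ ℝ).smulRight
          (2 * Real.pi * Complex.I * (i.1 : ℤ) * fourier (i.1 : ℤ) (y.1 : Torus1))) y := by
      have := (hasDerivAt_fourier' (i.1 : ℤ) y.1).hasFDerivAt.comp y
        (hasFDerivAt_fst (𝕜 := ℝ) (p := y))
      refine this.congr_fderiv ?_
      ext <;> simp
    have h2 : HasFDerivAt (fun y : ℝ × ℝ => fourier (-(i.2 : ℤ)) (y.2 : Torus1))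
        ((ContinuousLinearMap.snd ℝ ℝ ℝ).smulRight
          (2 * Real.pi * Complex.I * ((-(i.2 : ℤ) : ℤ) : ℂ) *
            fourier (-(i.2 : ℤ)) (y.2 : Torus1))) y := by
      have := (hasDerivAt_fourier' (-(i.2 : ℤ)) y.2).hasFDerivAt.comp y
        (hasFDerivAt_snd (𝕜 := ℝ) (p := y))
      refine this.congr_fderiv ?_
      ext <;> simp
    refine ((h1.mul h2).const_mul (c i)).congr_fderiv ?_
    refine ContinuousLinearMap.ext fun v => ?_
    simp only [hf', dFst, dSnd, _root_.add_apply, ContinuousLinearMap.smulRight_apply,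
      ContinuousLinearMap.coe_fst', ContinuousLinearMap.coe_snd', _root_.smul_apply,
      smul_eq_mul, Complex.real_smul]
    push_cast
    ring

theorem RapidDecay.isSmooth2 {c : ℕ × ℕ → ℂ} (hc : RapidDecay c) :
    IsSmooth2 (kernelSeries c) := by
  rw [IsSmooth2, contDiff_infty]
  intro n
  induction n generalizing c with
  | zero =>
    exact contDiff_zero.2 (continuous_iff_continuousAt.2 fun x =>
      (hasFDerivAt_kernelSeries hc x).continuousAt)
  | succ n ih =>
    have h := contDiff_succ_iff_fderiv (𝕜 := ℝ) (n := (n : WithTop ℕ∞))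
      (f := fun y : ℝ × ℝ => kernelSeries c ((y.1 : Torus1), (y.2 : Torus1)))
    push_cast
    refine h.2 ⟨fun x => (hasFDerivAt_kernelSeries hc x).differentiableAt, by simp, ?_⟩
    rw [funext fun x => (hasFDerivAt_kernelSeries hc x).fderiv]
    exact (contDiff_const.smulRight (ih hc.dFst)).add (contDiff_const.smulRight (ih hc.dSnd))

theorem pderivFst_kernelSeries {c : ℕ × ℕ → ℂ} (hc : RapidDecay c) :
    pderivFst (kernelSeries c) = kernelSeries (dFst c) := by
  funext p
  obtain ⟨t, s⟩ := p
  induction s using QuotientAddGroup.induction_on with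
  | H y =>
    refine congrFun (circleDeriv_eq (f := fun t => kernelSeries c (t, (y : Torus1)))
      (g := fun t => kernelSeries (dFst c) (t, (y : Torus1))) fun x => ?_) t
    have h2 : HasDerivAt (fun r : ℝ => (r, y)) ((1 : ℝ), (0 : ℝ)) x :=
      (hasDerivAt_id _).prodMk (hasDerivAt_const _ _)
    have := HasFDerivAt.comp_hasDerivAt (f := fun r : ℝ => (r, y)) x
      (hasFDerivAt_kernelSeries hc (x, y)) h2
    simpa [Function.comp_def] using this

theorem pderivSnd_kernelSeries {c : ℕ × ℕ → ℂ} (hc : RapidDecay c) :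
    pderivSnd (kernelSeries c) = kernelSeries (dSnd c) := by
  funext p
  obtain ⟨t, s⟩ := p
  induction t using QuotientAddGroup.induction_on with
  | H y =>
    refine congrFun (circleDeriv_eq (f := fun s => kernelSeries c ((y : Torus1), s))
      (g := fun s => kernelSeries (dSnd c) ((y : Torus1), s)) fun x => ?_) s
    have h2 : HasDerivAt (fun r : ℝ => (y, r)) ((0 : ℝ), (1 : ℝ)) x :=
      (hasDerivAt_const _ _).prodMk (hasDerivAt_id _)
    have := HasFDerivAt.comp_hasDerivAt (f := fun r : ℝ => (y, r)) x
      (hasFDerivAt_kernelSeries hc (y, x)) h2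
    simpa [Function.comp_def] using this

/-- `∂^l/∂t^l ∂^m/∂s^m` on matrices. -/
def dMat (l m : ℕ) (c : ℕ × ℕ → ℂ) : ℕ × ℕ → ℂ := fun i =>
  (2 * Real.pi * Complex.I * i.1) ^ l * ((-(2 * Real.pi * Complex.I * i.2)) ^ m * c i)

theorem dMat_eq (l m : ℕ) (c : ℕ × ℕ → ℂ) : dMat l m c = dFst^[l] (dSnd^[m] c) := by
  have h2 : ∀ m, dSnd^[m] c = dMat 0 m c := by
    intro m
    induction m with
    | zero => funext i; simp [dMat]
    | succ m ih =>
      rw [Function.iterate_succ_apply', ih]; funext i; simp [dMat, dSnd]; ring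
  induction l with
  | zero => exact (h2 m).symm
  | succ l ih =>
    rw [Function.iterate_succ_apply', ← ih]; funext i; simp [dMat, dFst]; ring

theorem RapidDecay.dSnd_iterate {c : ℕ × ℕ → ℂ} (hc : RapidDecay c) (m : ℕ) :
    RapidDecay (SmoothCompacts.dSnd^[m] c) := by
  induction m with
  | zero => exact hc
  | succ m ih => rw [Function.iterate_succ_apply']; exact ih.dSnd

theorem RapidDecay.dMat {c : ℕ × ℕ → ℂ} (hc : RapidDecay c) (l m : ℕ) :
    RapidDecay (dMat l m c) := by
  rw [dMat_eq]
  induction l with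
  | zero => exact hc.dSnd_iterate m
  | succ l ih => rw [Function.iterate_succ_apply']; exact ih.dFst

theorem pderiv_kernelSeries {c : ℕ × ℕ → ℂ} (hc : RapidDecay c) (l m : ℕ) :
    pderivFst^[l] (pderivSnd^[m] (kernelSeries c)) = kernelSeries (dMat l m c) := by
  have h2 : pderivSnd^[m] (kernelSeries c) = kernelSeries (dSnd^[m] c) := by
    induction m with
    | zero => rfl
    | succ m ih =>
      rw [Function.iterate_succ_apply', ih, pderivSnd_kernelSeries (hc.dSnd_iterate m),
        Function.iterate_succ_apply']
  rw [h2]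
  induction l with
  | zero => rw [dMat_eq]; rfl
  | succ l ih =>
    rw [Function.iterate_succ_apply', ih, pderivFst_kernelSeries (hc.dMat l m), dMat_eq, dMat_eq,
      Function.iterate_succ_apply']

theorem kernelSeries_add {c d : ℕ × ℕ → ℂ} (hc : RapidDecay c) (hd : RapidDecay d) :
    kernelSeries (c + d) = kernelSeries c + kernelSeries d := by
  funext p
  rw [Pi.add_apply, kernelSeries, kernelSeries, kernelSeries,
    ← Summable.tsum_add (hc.summable_term p) (hd.summable_term p)]
  simp only [Pi.add_apply, add_mul]

theorem kernelSeries_smul (a : ℂ) (c : ℕ × ℕ → ℂ) :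
    kernelSeries (a • c) = a • kernelSeries c := by
  funext p
  simp only [kernelSeries, Pi.smul_apply, smul_eq_mul, mul_assoc, tsum_mul_left]

theorem RapidDecay.smul {c : ℕ × ℕ → ℂ} (hc : RapidDecay c) (a : ℂ) : RapidDecay (a • c) :=
  hc.of_le 0 ‖a‖ fun i => by simp

/-! ### Rapid decay of the double Fourier coefficients of smooth functions -/

/-- The coefficients `∫ ∫ K (t, s) t ^ (-k) s ^ l ds dt`. -/
def kernelCoeff (K : Torus1 × Torus1 → ℂ) (i : ℕ × ℕ) : ℂ :=
  fourierCoeff (fun t => ∫ s, K (t, s) * fourier (i.2 : ℤ) s ∂haarAddCircle) (i.1 : ℤ)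

theorem kernelCoeff_eq (K : Torus1 × Torus1 → ℂ) (i : ℕ × ℕ) :
    kernelCoeff K i =
      fourierCoeff (fun t => fourierCoeff (fun s => K (t, s)) (-(i.2 : ℤ))) (i.1 : ℤ) := by
  simp [kernelCoeff, fourierCoeff, mul_comm]

theorem kernelCoeff_swap {K : Torus1 × Torus1 → ℂ} (hK : Continuous K) (i : ℕ × ℕ) :
    kernelCoeff K i =
      fourierCoeff (fun s => fourierCoeff (fun t => K (t, s)) (i.1 : ℤ)) (-(i.2 : ℤ)) := by
  rw [kernelCoeff_eq]
  simp only [fourierCoeff, smul_eq_mul, ← integral_const_mul]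
  rw [integral_integral_swap]
  · congr 1; funext s; congr 1; funext t; ring
  · refine Continuous.integrable_of_hasCompactSupport ?_ (HasCompactSupport.of_compactSpace _)
    simp only [Function.uncurry_def]
    fun_prop

theorem fst_iterate (K : Torus1 × Torus1 → ℂ) (p : ℕ) (t s : Torus1) :
    circleDeriv^[p] (fun t => K (t, s)) t = pderivFst^[p] K (t, s) := by
  induction p generalizing t with
  | zero => rfl
  | succ p ih =>
    rw [Function.iterate_succ_apply', Function.iterate_succ_apply', funext ih]; rfl

theorem snd_iterate (K : Torus1 × Torus1 → ℂ) (p : ℕ) (t s : Torus1) :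
    circleDeriv^[p] (fun s => K (t, s)) s = pderivSnd^[p] K (t, s) := by
  induction p generalizing s with
  | zero => rfl
  | succ p ih =>
    rw [Function.iterate_succ_apply', Function.iterate_succ_apply', funext ih]; rfl

theorem exists_bound {K : Torus1 × Torus1 → ℂ} (hK : Continuous K) : ∃ C, ∀ p, ‖K p‖ ≤ C := by
  obtain ⟨C, hC⟩ := bddAbove_norm hK
  exact ⟨C, fun p => hC ⟨p, rfl⟩⟩

theorem rapidDecay_kernelCoeff {K : Torus1 × Torus1 → ℂ} (hK : IsSmooth2 K) :
    RapidDecay (kernelCoeff K) := by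
  have hcont := isSmooth2_continuous hK
  have hA : ∀ p : ℕ, ∃ C, ∀ i : ℕ × ℕ, (i.1 : ℝ) ^ p * ‖kernelCoeff K i‖ ≤ C := by
    intro p
    obtain ⟨C, hC⟩ := exists_bound (isSmooth2_continuous (hK.iterate p 0))
    refine ⟨C, fun i => ?_⟩
    rw [kernelCoeff_swap hcont]
    have h := norm_fourierCoeff_le (f := fun s => ((i.1 : ℝ) ^ p : ℝ) •
      fourierCoeff (fun t => K (t, s)) (i.1 : ℤ)) (C := C) (fun s => by
        rw [norm_smul, norm_pow, Real.norm_natCast]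
        have := pow_mul_norm_fourierCoeff_le (hK.fst s) (p := p) (C := C)
          (fun t => by rw [fst_iterate]; exact hC (t, s)) (i.1 : ℤ)
        simpa using this) (-(i.2 : ℤ))
    have e : (fun s => ((i.1 : ℝ) ^ p : ℝ) • fourierCoeff (fun t => K (t, s)) (i.1 : ℤ)) =
        fun s => (((i.1 : ℝ) ^ p : ℝ) : ℂ) * fourierCoeff (fun t => K (t, s)) (i.1 : ℤ) := by
      funext s; simp
    rw [e, fourierCoeff.const_mul, norm_mul] at h
    simpa using h
  have hB : ∀ p : ℕ, ∃ C, ∀ i : ℕ × ℕ, (i.2 : ℝ) ^ p * ‖kernelCoeff K i‖ ≤ C := by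
    intro p
    obtain ⟨C, hC⟩ := exists_bound (isSmooth2_continuous (hK.iterate 0 p))
    refine ⟨C, fun i => ?_⟩
    rw [kernelCoeff_eq]
    have h := norm_fourierCoeff_le (f := fun t => ((i.2 : ℝ) ^ p : ℝ) •
      fourierCoeff (fun s => K (t, s)) (-(i.2 : ℤ))) (C := C) (fun t => by
        rw [norm_smul, norm_pow, Real.norm_natCast]
        have := pow_mul_norm_fourierCoeff_le (hK.snd t) (p := p) (C := C)
          (fun s => by rw [snd_iterate]; exact hC (t, s)) (-(i.2 : ℤ))
        simpa using this) (i.1 : ℤ)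
    have e : (fun t => ((i.2 : ℝ) ^ p : ℝ) • fourierCoeff (fun s => K (t, s)) (-(i.2 : ℤ))) =
        fun t => (((i.2 : ℝ) ^ p : ℝ) : ℂ) * fourierCoeff (fun s => K (t, s)) (-(i.2 : ℤ)) := by
      funext s; simp
    rw [e, fourierCoeff.const_mul, norm_mul] at h
    simpa using h
  intro p
  obtain ⟨C0, h0⟩ := hA 0
  obtain ⟨C1, h1⟩ := hA (p + 4)
  obtain ⟨C2, h2⟩ := hB (p + 4)
  have hC0 : 0 ≤ C0 := le_trans (by positivity) (h0 0)
  have hC1 : 0 ≤ C1 := le_trans (by positivity) (h1 0)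
  have hC2 : 0 ≤ C2 := le_trans (by positivity) (h2 0)
  have hsum : Summable fun i : ℕ × ℕ =>
      (3 ^ (p + 4) * (C0 + C1 + C2)) *
        ((1 / ((i.1 : ℝ) + 1) ^ 2) * (1 / ((i.2 : ℝ) + 1) ^ 2)) := by
    have h := (summable_nat_add_iff 1).2 (Real.summable_one_div_nat_pow.2 (one_lt_two))
    push_cast at h
    exact (h.mul_of_nonneg h (fun _ => by positivity) (fun _ => by positivity)).mul_left _
  refine Summable.of_nonneg_of_le (fun i => ?_) (fun i => ?_) hsum
  · have := one_le_weight i; positivity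
  · obtain ⟨k, l⟩ := i
    simp only
    set w : ℝ := 1 + (k : ℝ) + l with hw
    have hk : (0 : ℝ) ≤ k := Nat.cast_nonneg _
    have hl : (0 : ℝ) ≤ l := Nat.cast_nonneg _
    have hw4 : w ^ (p + 4) * ‖kernelCoeff K (k, l)‖ ≤ 3 ^ (p + 4) * (C0 + C1 + C2) := by
      have a0 := h0 (k, l)
      have a1 := h1 (k, l)
      have a2 := h2 (k, l)
      simp only [pow_zero, one_mul] at a0 a1 a2
      have hn := norm_nonneg (kernelCoeff K (k, l))
      have : w ^ (p + 4) ≤ 3 ^ (p + 4) * (1 + (k : ℝ) ^ (p + 4) + (l : ℝ) ^ (p + 4)) := by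
        have hm : w ≤ 3 * max 1 (max (k : ℝ) l) := by
          have i1 := le_max_left (1 : ℝ) (max (k : ℝ) l)
          have i2 := le_max_right (1 : ℝ) (max (k : ℝ) l)
          have i3 := le_max_left (k : ℝ) l
          have i4 := le_max_right (k : ℝ) l
          linarith
        calc w ^ (p + 4) ≤ (3 * max 1 (max (k : ℝ) l)) ^ (p + 4) := by
              gcongr
          _ = 3 ^ (p + 4) * (max 1 (max (k : ℝ) l)) ^ (p + 4) := mul_pow _ _ _
          _ ≤ _ := by
              gcongr
              have b1 : (0 : ℝ) ≤ (k : ℝ) ^ (p + 4) := by positivity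
              have b2 : (0 : ℝ) ≤ (l : ℝ) ^ (p + 4) := by positivity
              rcases max_choice (1 : ℝ) (max (k : ℝ) l) with h | h
              · rw [h, one_pow]; linarith
              · rw [h]
                rcases max_choice (k : ℝ) l with h | h <;> rw [h] <;> linarith
      calc w ^ (p + 4) * ‖kernelCoeff K (k, l)‖
          ≤ 3 ^ (p + 4) * (1 + (k : ℝ) ^ (p + 4) + (l : ℝ) ^ (p + 4)) *
              ‖kernelCoeff K (k, l)‖ := by gcongr
        _ = 3 ^ (p + 4) * (‖kernelCoeff K (k, l)‖ + (k : ℝ) ^ (p + 4) * ‖kernelCoeff K (k, l)‖ +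
              (l : ℝ) ^ (p + 4) * ‖kernelCoeff K (k, l)‖) := by ring
        _ ≤ _ := by gcongr
    have hden : ((k : ℝ) + 1) ^ 2 * ((l : ℝ) + 1) ^ 2 ≤ w ^ 4 := by
      have : ((k : ℝ) + 1) * ((l : ℝ) + 1) ≤ w ^ 2 := by rw [hw]; nlinarith
      calc ((k : ℝ) + 1) ^ 2 * ((l : ℝ) + 1) ^ 2 = (((k : ℝ) + 1) * ((l : ℝ) + 1)) ^ 2 := by ring
        _ ≤ (w ^ 2) ^ 2 := by gcongr
        _ = w ^ 4 := by ring
    rw [one_div_mul_one_div, mul_one_div, le_div_iff₀ (by positivity)]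
    have hwp : 0 ≤ w := by rw [hw]; positivity
    calc w ^ p * ‖kernelCoeff K (k, l)‖ * (((k : ℝ) + 1) ^ 2 * ((l : ℝ) + 1) ^ 2)
        ≤ w ^ p * ‖kernelCoeff K (k, l)‖ * w ^ 4 := by gcongr
      _ = w ^ (p + 4) * ‖kernelCoeff K (k, l)‖ := by rw [pow_add]; ring
      _ ≤ _ := hw4

/-! ### The Hardy space -/

/-- `L²(T)` for the normalized measure. -/
abbrev L2T : Type := Lp ℂ 2 (haarAddCircle : Measure Torus1)

/-- The Hardy space, the closed span of the functions `t ↦ t ^ n`, `n ≥ 0`, in `L²(T)`. -/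
def hardy : Submodule ℂ L2T :=
  (Submodule.span ℂ (Set.range fun n : ℕ => (fourierLp 2 (n : ℤ) : L2T))).topologicalClosure

/-- The Hardy space as a Hilbert space. -/
def H2 : Type := hardy

instance : NormedAddCommGroup H2 := inferInstanceAs (NormedAddCommGroup hardy)

instance : InnerProductSpace ℂ H2 := inferInstanceAs (InnerProductSpace ℂ hardy)

instance : CompleteSpace H2 :=
  (Submodule.isClosed_topologicalClosure _).completeSpace_coe

/-- The inclusion of the Hardy space in `L²(T)`. -/
def toL2 : H2 →ₗᵢ[ℂ] L2T := hardy.subtypeₗᵢ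

/-- The function `t ↦ t ^ n` as an element of the Hardy space. -/
def zpowH (n : ℕ) : H2 :=
  ⟨fourierLp 2 (n : ℤ), Submodule.le_topologicalClosure _ (Submodule.subset_span ⟨n, rfl⟩)⟩

theorem toL2_zpowH (n : ℕ) : toL2 (zpowH n) = fourierLp 2 (n : ℤ) := rfl

theorem orthonormal_zpowH : Orthonormal ℂ zpowH := by
  have h : Orthonormal ℂ fun n : ℕ => (fourierLp 2 (n : ℤ) : L2T) :=
    (orthonormal_fourier (T := 1)).comp _ Nat.cast_injective
  exact ⟨fun n => h.1 n, fun m n hmn => h.2 hmn⟩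

theorem top_le_closure_zpowH :
    (⊤ : Submodule ℂ H2) ≤ (Submodule.span ℂ (Set.range zpowH)).topologicalClosure := by
  intro x _
  have hx : toL2 x ∈ closure
      ((Submodule.span ℂ (Set.range fun n : ℕ => (fourierLp 2 (n : ℤ) : L2T)) : Submodule ℂ L2T) :
        Set L2T) := x.2
  change x ∈ closure _
  rw [toL2.isometry.isUniformInducing.isInducing.closure_eq_preimage_closure_image]
  convert! hx using 2
  have : (Set.range fun n : ℕ => (fourierLp 2 (n : ℤ) : L2T)) =
      toL2.toLinearMap '' (Set.range zpowH) := by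
    rw [← Set.range_comp]; rfl
  rw [this, Submodule.span_image]
  rfl

/-- The orthonormal basis `t ^ n`, `n ≥ 0`, of the Hardy space. -/
def hardyBasis : HilbertBasis ℕ ℂ H2 :=
  HilbertBasis.mk orthonormal_zpowH top_le_closure_zpowH

theorem hardyBasis_apply (n : ℕ) : hardyBasis n = zpowH n := by
  simp [hardyBasis]

theorem inner_zpowH (n : ℕ) (ξ : H2) : ⟪zpowH n, ξ⟫_ℂ = fourierCoeff (toL2 ξ) (n : ℤ) := by
  rw [← toL2.inner_map_map, toL2_zpowH, ← fourierBasis_repr, HilbertBasis.repr_apply_apply, coe_fourierBasis]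

/-- The matrix of an operator with respect to the basis `t ^ n`, `n ≥ 0`. -/
def matCoeff (S : H2 →L[ℂ] H2) (i : ℕ × ℕ) : ℂ := ⟪zpowH i.1, S (zpowH i.2)⟫_ℂ

theorem matCoeff_ext {S R : H2 →L[ℂ] H2} (h : ∀ i, matCoeff S i = matCoeff R i) : S = R := by
  have hd : Dense ((Submodule.span ℂ (Set.range hardyBasis) : Submodule ℂ H2) : Set H2) :=
    (Submodule.dense_iff_topologicalClosure_eq_top).2 hardyBasis.dense_span
  refine ContinuousLinearMap.ext_on hd ?_
  rintro _ ⟨l, rfl⟩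
  refine hardyBasis.repr.injective ?_
  ext k
  rw [HilbertBasis.repr_apply_apply, HilbertBasis.repr_apply_apply, hardyBasis_apply,
    hardyBasis_apply]
  exact h (k, l)

theorem matCoeff_add (S R : H2 →L[ℂ] H2) : matCoeff (S + R) = matCoeff S + matCoeff R := by
  funext i; simp [matCoeff]

theorem matCoeff_smul (a : ℂ) (S : H2 →L[ℂ] H2) : matCoeff (a • S) = a • matCoeff S := by
  funext i; simp [matCoeff]

theorem matCoeff_star (S : H2 →L[ℂ] H2) (i : ℕ × ℕ) :
    matCoeff (star S) i = conj (matCoeff S (i.2, i.1)) := by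
  simp [matCoeff, ContinuousLinearMap.star_eq_adjoint, ContinuousLinearMap.adjoint_inner_right]

theorem matCoeff_mul (S R : H2 →L[ℂ] H2) (k l : ℕ) :
    HasSum (fun j => matCoeff S (k, j) * matCoeff R (j, l)) (matCoeff (S * R) (k, l)) := by
  have h := hardyBasis.hasSum_inner_mul_inner (star S (zpowH k)) (R (zpowH l))
  simp only [ContinuousLinearMap.star_eq_adjoint, ContinuousLinearMap.adjoint_inner_left,
    hardyBasis_apply] at h
  exact h

/-- A product of rapidly decreasing matrices is controlled by the factors. -/
theorem summable_prod_weight {c d : ℕ × ℕ → ℂ} (hc : RapidDecay c) (hd : RapidDecay d) (p : ℕ) :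
    Summable fun x : (ℕ × ℕ) × ℕ =>
      (1 + (x.1.1 : ℝ) + x.1.2) ^ p * ‖c (x.1.1, x.2) * d (x.2, x.1.2)‖ := by
  have h := ((hc p).mul_of_nonneg (hd p) (fun i => by
    have := one_le_weight i; positivity) (fun i => by have := one_le_weight i; positivity))
  have hinj : Function.Injective
      (fun x : (ℕ × ℕ) × ℕ => (((x.1.1, x.2), (x.2, x.1.2)) : (ℕ × ℕ) × (ℕ × ℕ))) := by
    rintro ⟨⟨a, b⟩, c⟩ ⟨⟨a', b'⟩, c'⟩ h
    simp only [Prod.mk.injEq] at h ⊢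
    tauto
  refine Summable.of_nonneg_of_le (fun x => ?_) (fun x => ?_) (h.comp_injective hinj)
  · have := one_le_weight x.1; positivity
  · simp only [Function.comp_apply]
    have h1 : (0 : ℝ) ≤ x.1.1 := Nat.cast_nonneg _
    have h2 : (0 : ℝ) ≤ x.1.2 := Nat.cast_nonneg _
    have h3 : (0 : ℝ) ≤ x.2 := Nat.cast_nonneg _
    have : (1 + (x.1.1 : ℝ) + x.1.2) ≤ (1 + (x.1.1 : ℝ) + x.2) * (1 + (x.2 : ℝ) + x.1.2) := by
      nlinarith [mul_nonneg h1 h3, mul_nonneg h1 h2, mul_nonneg h3 h2, mul_nonneg h3 h3]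
    calc (1 + (x.1.1 : ℝ) + x.1.2) ^ p * ‖c (x.1.1, x.2) * d (x.2, x.1.2)‖
        ≤ ((1 + (x.1.1 : ℝ) + x.2) * (1 + (x.2 : ℝ) + x.1.2)) ^ p *
            ‖c (x.1.1, x.2) * d (x.2, x.1.2)‖ := by gcongr
      _ = _ := by rw [norm_mul, mul_pow]; ring

theorem RapidDecay.matCoeff_mul {S R : H2 →L[ℂ] H2} (hS : RapidDecay (matCoeff S))
    (hR : RapidDecay (matCoeff R)) : RapidDecay (matCoeff (S * R)) := by
  intro p
  have h := summable_prod_weight hS hR p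
  have h0 := h.prod
  refine Summable.of_nonneg_of_le (fun i => ?_) (fun i => ?_) h0
  · have := one_le_weight i; positivity
  · obtain ⟨k, l⟩ := i
    have hw := one_le_weight (k, l)
    simp only at hw ⊢
    rw [← (SmoothCompacts.matCoeff_mul S R k l).tsum_eq, tsum_mul_left]
    gcongr
    refine norm_tsum_le_tsum_norm ?_
    have h1 := h.prod_factor (k, l)
    simp only at h1
    refine (summable_mul_left_iff (a := (1 + (k : ℝ) + l) ^ p) (by positivity)).1 h1

theorem RapidDecay.matCoeff_star {S : H2 →L[ℂ] H2} (hS : RapidDecay (matCoeff S)) :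
    RapidDecay (matCoeff (star S)) := by
  intro p
  refine ((hS p).comp_injective Prod.swap_injective).congr fun i => ?_
  simp only [Function.comp_apply, Prod.fst_swap, Prod.snd_swap]
  rw [SmoothCompacts.matCoeff_star, RCLike.norm_conj]
  simp only [Prod.swap]
  ring

/-! ### Operators with smooth kernels -/

/-- `S` is the integral operator `(S ξ) (t) = ∫ K (t, s) ξ (s) ds` on the Hardy space. -/
def HasKernel (S : H2 →L[ℂ] H2) (K : Torus1 × Torus1 → ℂ) : Prop :=
  ∀ ξ : H2, toL2 (S ξ) =ᵐ[haarAddCircle] fun t => ∫ s, K (t, s) * toL2 ξ s ∂haarAddCircle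

/-- The compact operators on the Hardy space that have a kernel in `C^∞(T × T)`. -/
def IsSmoothCompact (S : H2 →L[ℂ] H2) : Prop :=
  IsCompactOperator S ∧ ∃ K : Torus1 × Torus1 → ℂ, IsSmooth2 K ∧ HasKernel S K

theorem matCoeff_of_hasKernel {S : H2 →L[ℂ] H2} {K : Torus1 × Torus1 → ℂ} (h : HasKernel S K) :
    matCoeff S = kernelCoeff K := by
  funext i
  rw [matCoeff, inner_zpowH, kernelCoeff]
  refine congrFun (fourierCoeff_congr_ae ((h _).trans (Eventually.of_forall fun t => ?_))) _
  refine integral_congr_ae ?_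
  filter_upwards [coeFn_fourierLp (T := 1) 2 (i.2 : ℤ)] with s hs
  rw [toL2_zpowH, hs]

theorem IsSmoothCompact.rapidDecay {S : H2 →L[ℂ] H2} (h : IsSmoothCompact S) :
    RapidDecay (matCoeff S) := by
  obtain ⟨-, K, hK, hS⟩ := h
  rw [matCoeff_of_hasKernel hS]
  exact rapidDecay_kernelCoeff hK

theorem isCompactOperator_of_summable_matrix {E : Type*} [NormedAddCommGroup E]
    [InnerProductSpace ℂ E] [CompleteSpace E] (b : HilbertBasis ℕ ℂ E) (S : E →L[ℂ] E)
    (h : Summable fun i : ℕ × ℕ => ‖⟪b i.1, S (b i.2)⟫_ℂ‖) : IsCompactOperator S := by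
  have hn : ∀ n, ‖b n‖ = 1 := b.orthonormal.1
  have ho := orthonormal_iff_ite.1 b.orthonormal
  let F : ℕ × ℕ → (E →L[ℂ] E) := fun i =>
    ⟪b i.1, S (b i.2)⟫_ℂ • InnerProductSpace.rankOne ℂ (b i.1) (b i.2)
  have hs : Summable F := by
    refine Summable.of_norm (h.congr fun i => ?_)
    simp only [F]
    rw [norm_smul, InnerProductSpace.norm_rankOne, hn, hn]; simp
  have hd : Dense ((Submodule.span ℂ (Set.range b) : Submodule ℂ E) : Set E) :=
    (Submodule.dense_iff_topologicalClosure_eq_top).2 b.dense_span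
  have heq : ∑' i, F i = S := by
    refine ContinuousLinearMap.ext_on hd ?_
    rintro _ ⟨l, rfl⟩
    refine b.repr.injective ?_
    ext k
    rw [HilbertBasis.repr_apply_apply, HilbertBasis.repr_apply_apply]
    have h1 : HasSum (fun j => ⟪b k, F j (b l)⟫_ℂ) ⟪b k, (∑' i, F i) (b l)⟫_ℂ :=
      (hs.hasSum.mapL (ContinuousLinearMap.apply ℂ E (b l))).mapL (innerSL ℂ (b k))
    refine h1.unique ?_
    have e : (fun j => ⟪b k, F j (b l)⟫_ℂ) =
        fun j : ℕ × ℕ => if j = (k, l) then ⟪b k, S (b l)⟫_ℂ else 0 := by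
      funext j
      obtain ⟨c, d⟩ := j
      simp only [F, _root_.smul_apply, InnerProductSpace.rankOne_apply, inner_smul_right, ho]
      by_cases h1 : k = c <;> by_cases h2 : d = l
      · subst h1 h2; simp
      · simp [h2]
      · simp [h1, Ne.symm h1]
      · simp [h2]
    rw [e]
    exact hasSum_ite_eq _ _
  have hS : HasSum F S := heq ▸ hs.hasSum
  refine isCompactOperator_of_tendsto hS (Eventually.of_forall fun s => ?_)
  change (∑ b ∈ s, F b) ∈ compactOperator (RingHom.id ℂ) E E
  refine Submodule.sum_mem _ fun i _ => Submodule.smul_mem _ _ ?_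
  change IsCompactOperator _
  rw [InnerProductSpace.rankOne_def']
  exact (isCompactOperator_of_locallyCompactSpace_rng
    (ContinuousLinearMap.toSpanSingleton ℂ (b i.1))).comp_clm _

theorem RapidDecay.isCompactOperator {S : H2 →L[ℂ] H2} (h : RapidDecay (matCoeff S)) :
    IsCompactOperator S := by
  refine isCompactOperator_of_summable_matrix hardyBasis S (h.summable.congr fun i => ?_)
  rw [hardyBasis_apply, hardyBasis_apply]; rfl

theorem RapidDecay.hasKernel {S : H2 →L[ℂ] H2} (h : RapidDecay (matCoeff S)) :
    HasKernel S (kernelSeries (matCoeff S)) := by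
  intro ξ
  set c := matCoeff S with hc
  set x : ℕ → ℂ := fun l => fourierCoeff (toL2 ξ) (l : ℤ) with hx
  have hxb : ∀ l, ‖x l‖ ≤ ‖ξ‖ := fun l => by
    rw [hx]; simp only; rw [← inner_zpowH]
    refine (norm_inner_le_norm (𝕜 := ℂ) (zpowH l) ξ).trans ?_
    rw [orthonormal_zpowH.1, one_mul]
  have hξ : Integrable (toL2 ξ) (haarAddCircle : Measure Torus1) :=
    (Lp.memLp (toL2 ξ)).integrable (by norm_num)
  have hs2 : Summable fun i : ℕ × ℕ => ‖c i * x i.2‖ := by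
    refine Summable.of_nonneg_of_le (fun _ => norm_nonneg _) (fun i => ?_)
      (h.summable.mul_right ‖ξ‖)
    rw [norm_mul]; gcongr; exact hxb _
  have hint : ∀ t, ∫ s, kernelSeries c (t, s) * toL2 ξ s ∂haarAddCircle =
      ∑' i : ℕ × ℕ, c i * x i.2 * fourier (i.1 : ℤ) t := by
    intro t
    have hi := hasSum_integral_of_summable_integral_norm (μ := (haarAddCircle : Measure Torus1))
      (F := fun (i : ℕ × ℕ) s => c i * fourier (i.1 : ℤ) t *
        (fourier (-(i.2 : ℤ)) s • toL2 ξ s))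
      (fun i => (hξ.fourier_smul _).const_mul _) (by
        simp only [norm_mul, norm_smul, norm_fourier, mul_one, one_mul, integral_const_mul]
        exact h.summable.mul_right _)
    calc ∫ s, kernelSeries c (t, s) * toL2 ξ s ∂haarAddCircle
        = ∫ s, ∑' i : ℕ × ℕ, c i * fourier (i.1 : ℤ) t *
            (fourier (-(i.2 : ℤ)) s • toL2 ξ s) ∂haarAddCircle := by
          refine integral_congr_ae (Eventually.of_forall fun s => ?_)
          simp only [kernelSeries, ← tsum_mul_right, smul_eq_mul]
          refine tsum_congr fun i => ?_
          ring
      _ = ∑' i : ℕ × ℕ, c i * fourier (i.1 : ℤ) t * x i.2 := by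
          rw [← hi.tsum_eq]
          refine tsum_congr fun i => ?_
          rw [integral_const_mul]; rfl
      _ = _ := tsum_congr fun i => by ring
  have hy : ∀ k, HasSum (fun l => c (k, l) * x l) (⟪zpowH k, S ξ⟫_ℂ) := by
    intro k
    have h := hardyBasis.hasSum_inner_mul_inner (star S (zpowH k)) ξ
    simp only [ContinuousLinearMap.star_eq_adjoint, ContinuousLinearMap.adjoint_inner_left,
      hardyBasis_apply] at h
    refine h.congr_fun fun l => ?_
    rw [hx, hc, matCoeff, inner_zpowH l ξ]
  set y : ℕ → ℂ := fun k => ⟪zpowH k, S ξ⟫_ℂ with hydef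
  have hys : Summable fun k => ‖y k‖ := by
    refine Summable.of_nonneg_of_le (fun _ => norm_nonneg _) (fun k => ?_) hs2.prod
    rw [show y k = ⟪zpowH k, S ξ⟫_ℂ from rfl, ← (hy k).tsum_eq]
    exact norm_tsum_le_tsum_norm (hs2.prod_factor k)
  have hG : Summable fun k : ℕ => y k • (fourier (k : ℤ) : C(Torus1, ℂ)) := by
    refine Summable.of_norm (hys.congr fun k => ?_)
    rw [norm_smul, fourier_norm, mul_one]
  set G : C(Torus1, ℂ) := ∑' k : ℕ, y k • (fourier (k : ℤ) : C(Torus1, ℂ)) with hGdef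
  have hGS : ContinuousMap.toLp (E := ℂ) 2 haarAddCircle ℂ G = toL2 (S ξ) := by
    have h1 := hG.hasSum.mapL (ContinuousMap.toLp (E := ℂ) 2 (haarAddCircle : Measure Torus1) ℂ)
    have h2 := (hardyBasis.hasSum_repr (S ξ)).mapL toL2.toContinuousLinearMap
    refine h1.unique (h2.congr_fun fun k => ?_)
    rw [HilbertBasis.repr_apply_apply, hardyBasis_apply, map_smul, map_smul]
    rfl
  have hGe : ∀ t, G t = ∑' i : ℕ × ℕ, c i * x i.2 * fourier (i.1 : ℤ) t := by
    intro t
    have h1 := (hG.hasSum.mapL (ContinuousMap.evalCLM ℂ t)).tsum_eq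
    have hs3 : Summable fun i : ℕ × ℕ => c i * x i.2 * fourier (i.1 : ℤ) t := by
      refine Summable.of_norm (hs2.congr fun i => ?_)
      rw [norm_mul _ (fourier _ t), norm_fourier, mul_one]
    rw [hs3.tsum_prod]
    refine h1.symm.trans (tsum_congr fun k => ?_)
    simp only [tsum_mul_right, (hy k).tsum_eq]
    rfl
  filter_upwards [ContinuousMap.coeFn_toLp (E := ℂ) (p := 2) (𝕜 := ℂ)
    (haarAddCircle : Measure Torus1) G] with t ht
  rw [hint, ← hGe, ← ht, hGS]

theorem isSmoothCompact_iff {S : H2 →L[ℂ] H2} : IsSmoothCompact S ↔ RapidDecay (matCoeff S) :=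
  ⟨fun h => h.rapidDecay, fun h => ⟨h.isCompactOperator, _, h.isSmooth2, h.hasKernel⟩⟩

/-- The algebra `K^∞` of smooth compact operators on the Hardy space, with the composition and the
adjoint of operators. -/
def smoothCompacts : NonUnitalStarSubalgebra ℂ (H2 →L[ℂ] H2) where
  carrier := {S | IsSmoothCompact S}
  add_mem' {S R} hS hR := isSmoothCompact_iff.2 (by
    rw [matCoeff_add]; exact (IsSmoothCompact.rapidDecay hS).add (IsSmoothCompact.rapidDecay hR))
  zero_mem' := isSmoothCompact_iff.2 (by
    intro p; simp [matCoeff])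
  mul_mem' {S R} hS hR := isSmoothCompact_iff.2
    ((IsSmoothCompact.rapidDecay hS).matCoeff_mul (IsSmoothCompact.rapidDecay hR))
  smul_mem' a S hS := isSmoothCompact_iff.2 (by
    rw [matCoeff_smul]; exact (IsSmoothCompact.rapidDecay hS).smul a)
  star_mem' {S} hS := isSmoothCompact_iff.2 (IsSmoothCompact.rapidDecay hS).matCoeff_star

/-- The underlying type of `K^∞` (it will carry its own topology, not the norm topology). -/
def KInf : Type := smoothCompacts

namespace KInf

instance : NonUnitalRing KInf := inferInstanceAs (NonUnitalRing smoothCompacts)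
instance : Module ℂ KInf := inferInstanceAs (Module ℂ smoothCompacts)
instance : IsScalarTower ℂ KInf KInf := inferInstanceAs (IsScalarTower ℂ smoothCompacts smoothCompacts)
instance : SMulCommClass ℂ KInf KInf := inferInstanceAs (SMulCommClass ℂ smoothCompacts smoothCompacts)
instance : StarRing KInf := inferInstanceAs (StarRing smoothCompacts)
instance : StarModule ℂ KInf := inferInstanceAs (StarModule ℂ smoothCompacts)

/-- The operator on the Hardy space given by an element of `K^∞`. -/
def op (S : KInf) : H2 →L[ℂ] H2 := S.1

theorem ext_op {S R : KInf} (h : S.op = R.op) : S = R := Subtype.ext h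
theorem op_add (S R : KInf) : (S + R).op = S.op + R.op := rfl
theorem op_zero : (0 : KInf).op = 0 := rfl
theorem op_mul (S R : KInf) : (S * R).op = S.op * R.op := rfl
theorem op_smul (a : ℂ) (S : KInf) : (a • S).op = a • S.op := rfl
theorem op_star (S : KInf) : (star S).op = star S.op := rfl

theorem rapidDecay (S : KInf) : RapidDecay (matCoeff S.op) := IsSmoothCompact.rapidDecay S.2

end KInf

/-- The kernel function `K_S` of `S`, i.e. the smooth kernel of `S` whose Fourier expansion contains
only the functions `t ^ k s ^ (-l)` with `k, l ≥ 0`; its Fourier coefficients are the matrix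
coefficients of `S`. (Functions `g (t) s ^ j` with `j ≥ 1` are kernels of the operator `0`.) -/
def kernelFun (S : KInf) : Torus1 × Torus1 → ℂ :=
  kernelSeries (matCoeff S.op)

theorem kernelFun_isSmooth2 (S : KInf) : IsSmooth2 (kernelFun S) := S.rapidDecay.isSmooth2

theorem kernelFun_hasKernel (S : KInf) : HasKernel S.op (kernelFun S) :=
  S.rapidDecay.hasKernel

/-- The seminorm `‖S‖_{l, m} = sup |∂^{l+m} K_S / ∂t^l ∂s^m|` on `K^∞`. -/
def kernelSeminorm (i : ℕ × ℕ) : Seminorm ℂ KInf :=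
  Seminorm.of (fun S => ⨆ p, ‖pderivFst^[i.1] (pderivSnd^[i.2] (kernelFun S)) p‖)
    (fun S R => by
      have hS := bddAbove_norm (isSmooth2_continuous ((kernelFun_isSmooth2 S).iterate i.1 i.2))
      have hR := bddAbove_norm (isSmooth2_continuous ((kernelFun_isSmooth2 R).iterate i.1 i.2))
      have h : pderivFst^[i.1] (pderivSnd^[i.2] (kernelFun (S + R))) =
          pderivFst^[i.1] (pderivSnd^[i.2] (kernelFun S)) +
            pderivFst^[i.1] (pderivSnd^[i.2] (kernelFun R)) := by
        simp only [kernelFun]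
        rw [pderiv_kernelSeries (S + R).rapidDecay, pderiv_kernelSeries S.rapidDecay,
          pderiv_kernelSeries R.rapidDecay,
          ← kernelSeries_add (S.rapidDecay.dMat _ _) (R.rapidDecay.dMat _ _)]
        congr 1
        funext j
        have := congrFun (matCoeff_add S.op R.op) j
        simp only [dMat, Pi.add_apply, KInf.op_add, this]
        ring
      refine ciSup_le fun p => ?_
      rw [h]
      exact (norm_add_le _ _).trans (add_le_add (le_ciSup hS p) (le_ciSup hR p)))
    (fun a S => by
      have h : pderivFst^[i.1] (pderivSnd^[i.2] (kernelFun (a • S))) =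
          a • pderivFst^[i.1] (pderivSnd^[i.2] (kernelFun S)) := by
        simp only [kernelFun]
        rw [pderiv_kernelSeries (a • S).rapidDecay, pderiv_kernelSeries S.rapidDecay,
          ← kernelSeries_smul]
        congr 1
        funext j
        have := congrFun (matCoeff_smul a S.op) j
        simp only [dMat, Pi.smul_apply, smul_eq_mul, KInf.op_smul, this]
        ring
      simp only [h, Pi.smul_apply, norm_smul]
      rw [Real.mul_iSup_of_nonneg (norm_nonneg a)])

theorem kernelSeminorm_apply (i : ℕ × ℕ) (S : KInf) :
    kernelSeminorm i S = ⨆ p, ‖pderivFst^[i.1] (pderivSnd^[i.2] (kernelFun S)) p‖ := rfl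

theorem kernelSeminorm_eq (i : ℕ × ℕ) (S : KInf) :
    kernelSeminorm i S = ⨆ p, ‖kernelSeries (dMat i.1 i.2 (matCoeff S.op)) p‖ := by
  rw [kernelSeminorm_apply, kernelFun, pderiv_kernelSeries S.rapidDecay]

theorem norm_kernelSeries_le_seminorm (l m : ℕ) (S : KInf) (p : Torus1 × Torus1) :
    ‖kernelSeries (dMat l m (matCoeff S.op)) p‖ ≤ kernelSeminorm (l, m) S := by
  rw [kernelSeminorm_eq]
  exact le_ciSup (f := fun p => ‖kernelSeries (dMat l m (matCoeff S.op)) p‖)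
    (bddAbove_norm (isSmooth2_continuous (S.rapidDecay.dMat l m).isSmooth2)) p

/-! ### Estimates for products and adjoints -/

theorem integral_kernelSeries_mul {c : ℕ × ℕ → ℂ} (h : RapidDecay c) {g : Torus1 → ℂ}
    (hg : Integrable g haarAddCircle) (t : Torus1) :
    ∫ s, kernelSeries c (t, s) * g s ∂haarAddCircle =
      ∑' i : ℕ × ℕ, c i * fourier (i.1 : ℤ) t * fourierCoeff g (i.2 : ℤ) := by
  have hi := hasSum_integral_of_summable_integral_norm (μ := (haarAddCircle : Measure Torus1))
    (F := fun (i : ℕ × ℕ) s => c i * fourier (i.1 : ℤ) t * (fourier (-(i.2 : ℤ)) s • g s))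
    (fun i => (hg.fourier_smul _).const_mul _) (by
      simp only [norm_mul, norm_smul, norm_fourier, mul_one, one_mul, integral_const_mul]
      exact h.summable.mul_right _)
  calc ∫ s, kernelSeries c (t, s) * g s ∂haarAddCircle
      = ∫ s, ∑' i : ℕ × ℕ, c i * fourier (i.1 : ℤ) t *
          (fourier (-(i.2 : ℤ)) s • g s) ∂haarAddCircle := by
        refine integral_congr_ae (Eventually.of_forall fun s => ?_)
        simp only [kernelSeries, ← tsum_mul_right, smul_eq_mul]
        refine tsum_congr fun i => ?_
        ring
    _ = _ := by
        rw [← hi.tsum_eq]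
        refine tsum_congr fun i => ?_
        rw [integral_const_mul]; rfl

theorem fourierCoeff_kernelSeries {d : ℕ × ℕ → ℂ} (h : RapidDecay d) (s : Torus1) (j : ℕ) :
    fourierCoeff (fun r => kernelSeries d (r, s)) (j : ℤ) =
      ∑' l, d (j, l) * fourier (-(l : ℤ)) s := by
  have hint : ∀ n : ℤ, Integrable (fun r : Torus1 => fourier n r) haarAddCircle := fun n =>
    (fourier n).continuous.integrable_of_hasCompactSupport (HasCompactSupport.of_compactSpace _)
  have hi := hasSum_integral_of_summable_integral_norm (μ := (haarAddCircle : Measure Torus1))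
    (F := fun (i : ℕ × ℕ) r => d i * fourier (-(i.2 : ℤ)) s * fourier ((i.1 : ℤ) - j) r)
    (fun i => (hint _).const_mul _) (by
      simp only [norm_mul, norm_fourier, mul_one, integral_const, smul_eq_mul, measureReal_def,
        measure_univ, ENNReal.toReal_one, one_mul]
      exact h.summable)
  have hz : ∀ n : ℤ, ∫ r, fourier n r ∂(haarAddCircle : Measure Torus1) = if n = 0 then 1 else 0 := by
    intro n
    have := congrFun (fourierCoeff_fourier (T := 1) n) 0
    simpa [fourierCoeff, Pi.single_apply, eq_comm] using this
  calc fourierCoeff (fun r => kernelSeries d (r, s)) (j : ℤ)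
      = ∫ r, ∑' i : ℕ × ℕ, d i * fourier (-(i.2 : ℤ)) s * fourier ((i.1 : ℤ) - j) r
          ∂haarAddCircle := by
        refine integral_congr_ae (Eventually.of_forall fun r => ?_)
        simp only [kernelSeries, smul_eq_mul, ← tsum_mul_left]
        refine tsum_congr fun i => ?_
        rw [sub_eq_add_neg, fourier_add]; ring
    _ = ∑' i : ℕ × ℕ, if i.1 = j then d i * fourier (-(i.2 : ℤ)) s else 0 := by
        rw [← hi.tsum_eq]
        refine tsum_congr fun i => ?_
        rw [integral_const_mul, hz]
        simp only [sub_eq_zero, Nat.cast_inj, mul_ite, mul_one, mul_zero]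
    _ = _ := by
        have hs : Summable fun i : ℕ × ℕ =>
            if i.1 = j then d i * fourier (-(i.2 : ℤ)) s else 0 := by
          refine Summable.of_norm_bounded h.summable fun i => ?_
          split_ifs
          · rw [norm_mul, norm_fourier, mul_one]
          · simp
        rw [hs.tsum_prod, tsum_eq_single j]
        · simp
        · intro k hk; simp [hk]

theorem integral_kernelSeries {c d : ℕ × ℕ → ℂ} (hc : RapidDecay c) (hd : RapidDecay d)
    (t s : Torus1) :
    ∫ r, kernelSeries c (t, r) * kernelSeries d (r, s) ∂haarAddCircle =
      kernelSeries (fun i => ∑' j, c (i.1, j) * d (j, i.2)) (t, s) := by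
  have hg : Integrable (fun r => kernelSeries d (r, s)) (haarAddCircle : Measure Torus1) :=
    ((hd.isSmooth2.fst s).continuous).integrable_of_hasCompactSupport
      (HasCompactSupport.of_compactSpace _)
  rw [integral_kernelSeries_mul hc hg]
  let G : (ℕ × ℕ) × ℕ → ℂ := fun x =>
    c (x.1.1, x.2) * d (x.2, x.1.2) * (fourier (x.1.1 : ℤ) t * fourier (-(x.1.2 : ℤ)) s)
  have hG : Summable G := by
    refine Summable.of_norm ((summable_prod_weight hc hd 0).congr fun x => ?_)
    simp only [G]
    rw [norm_mul _ (_ * _), norm_mul (fourier _ t), norm_fourier, norm_fourier]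
    simp
  let e : (ℕ × ℕ) × ℕ ≃ (ℕ × ℕ) × ℕ :=
    ⟨fun x => ((x.1.1, x.2), x.1.2), fun x => ((x.1.1, x.2), x.1.2), fun x => rfl, fun x => rfl⟩
  have hGe : Summable fun x => G (e x) := e.summable_iff.2 hG
  have h1 := hG.tsum_prod
  have h2 := hGe.tsum_prod
  rw [e.tsum_eq G, h1] at h2
  simp only [kernelSeries, ← tsum_mul_right]
  refine Eq.trans ?_ h2.symm
  refine tsum_congr fun i => ?_
  have h3 := fourierCoeff_kernelSeries hd s i.2
  simp only [kernelSeries] at h3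
  rw [h3, ← tsum_mul_left]
  refine tsum_congr fun l => ?_
  simp only [G, e, Equiv.coe_fn_mk]
  ring

theorem kernelSeminorm_mul_le (l m : ℕ) (S R : KInf) :
    kernelSeminorm (l, m) (S * R) ≤ kernelSeminorm (l, 0) S * kernelSeminorm (0, m) R := by
  rw [kernelSeminorm_eq]
  refine ciSup_le fun p => ?_
  obtain ⟨t, s⟩ := p
  have e : dMat l m (matCoeff (S * R).op) = fun i : ℕ × ℕ =>
      ∑' j, dMat l 0 (matCoeff S.op) (i.1, j) *
        dMat 0 m (matCoeff R.op) (j, i.2) := by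
    funext i
    obtain ⟨k, n⟩ := i
    simp only [dMat, KInf.op_mul]
    rw [← (matCoeff_mul S.op R.op k n).tsum_eq, ← tsum_mul_left, ← tsum_mul_left]
    refine tsum_congr fun j => ?_
    ring
  simp only
  rw [e, ← integral_kernelSeries (S.rapidDecay.dMat l 0) (R.rapidDecay.dMat 0 m)]
  have := norm_integral_le_of_norm_le_const (μ := (haarAddCircle : Measure Torus1))
    (f := fun r => kernelSeries (dMat l 0 (matCoeff S.op)) (t, r) *
      kernelSeries (dMat 0 m (matCoeff R.op)) (r, s))
    (C := kernelSeminorm (l, 0) S * kernelSeminorm (0, m) R)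
    (Eventually.of_forall fun r => by
      rw [norm_mul]
      exact mul_le_mul (norm_kernelSeries_le_seminorm l 0 S _)
        (norm_kernelSeries_le_seminorm 0 m R _) (norm_nonneg _) (apply_nonneg _ _))
  simpa using this

theorem kernelSeminorm_star_le (l m : ℕ) (S : KInf) :
    kernelSeminorm (l, m) (star S) ≤ kernelSeminorm (m, l) S := by
  rw [kernelSeminorm_eq]
  refine ciSup_le fun p => ?_
  obtain ⟨t, s⟩ := p
  refine le_trans (le_of_eq ?_) (norm_kernelSeries_le_seminorm m l S (s, t))
  rw [← RCLike.norm_conj]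
  congr 1
  simp only [kernelSeries]
  rw [Complex.conj_tsum, ← (Equiv.prodComm ℕ ℕ).tsum_eq]
  refine tsum_congr fun i => ?_
  simp only [dMat, Equiv.prodComm_apply, Prod.fst_swap, Prod.snd_swap, KInf.op_star, matCoeff_star, map_mul, map_pow, map_neg, Complex.conj_conj,
    ← fourier_neg, neg_neg, Complex.conj_ofReal, Complex.conj_I, Complex.conj_natCast, map_ofNat]
  ring

/-! ### The gauge action -/

/-- Rotation `ξ ↦ (t ↦ ξ (exp (2 π i θ) t))` on `L²(T)`. -/
def rotL2 (θ : ℝ) : L2T →ₗᵢ[ℂ] L2T :=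
  Lp.compMeasurePreservingₗᵢ ℂ (fun t : Torus1 => t + (θ : Torus1))
    (measurePreserving_add_right haarAddCircle (θ : Torus1))

theorem rotL2_fourierLp (θ : ℝ) (n : ℤ) :
    rotL2 θ (fourierLp 2 n) = fourier n (θ : Torus1) • (fourierLp 2 n : L2T) := by
  refine Lp.ext ?_
  have h1 := Lp.coeFn_compMeasurePreserving (fourierLp 2 n : L2T)
    (measurePreserving_add_right haarAddCircle (θ : Torus1))
  have h2 := (measurePreserving_add_right haarAddCircle (θ : Torus1)).quasiMeasurePreserving.ae_eq_comp
    (coeFn_fourierLp (T := 1) 2 n)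
  filter_upwards [h1, h2, Lp.coeFn_smul (fourier n (θ : Torus1)) (fourierLp 2 n : L2T),
    coeFn_fourierLp (T := 1) 2 n] with t a1 a2 a3 a4
  rw [a3, Pi.smul_apply, a4, smul_eq_mul]
  refine a1.trans (a2.trans ?_)
  simp only [Function.comp_apply]
  rw [fourier_apply, fourier_apply, fourier_apply, smul_add, AddCircle.toCircle_add]
  push_cast; ring

theorem rotL2_mem (θ : ℝ) (ξ : H2) : rotL2 θ (toL2 ξ) ∈ hardy := by
  have h : hardy ≤ hardy.comap (rotL2 θ).toLinearMap := by
    refine Submodule.topologicalClosure_minimal _ ?_ ?_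
    · rw [Submodule.span_le]
      rintro _ ⟨n, rfl⟩
      simp only [Submodule.comap_coe, Set.mem_preimage, SetLike.mem_coe]
      change rotL2 θ (fourierLp 2 (n : ℤ)) ∈ hardy
      rw [rotL2_fourierLp]
      exact hardy.smul_mem _ (zpowH n).2
    · exact (Submodule.isClosed_topologicalClosure _).preimage (rotL2 θ).continuous
  exact h ξ.2

/-- The operator `U_θ ξ (t) = ξ (exp (2 π i θ) t)` on the Hardy space. -/
def rotH (θ : ℝ) : H2 →L[ℂ] H2 :=
  ((rotL2 θ).toContinuousLinearMap.comp toL2.toContinuousLinearMap).codRestrict hardy (rotL2_mem θ)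

theorem rotH_zpowH (θ : ℝ) (n : ℕ) : rotH θ (zpowH n) = fourier (n : ℤ) (θ : Torus1) • zpowH n :=
  Subtype.ext (rotL2_fourierLp θ n)

theorem rotH_add (θ φ : ℝ) : rotH (θ + φ) = rotH θ * rotH φ := by
  refine matCoeff_ext fun i => ?_
  simp only [matCoeff, mul_apply_eq_comp, rotH_zpowH, map_smul, smul_smul]
  congr 2
  rw [fourier_apply, fourier_apply, fourier_apply, ← Circle.coe_mul, ← AddCircle.toCircle_add,
    ← smul_add, ← AddCircle.coe_add, add_comm]

theorem rotH_zero : rotH 0 = 1 := by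
  refine matCoeff_ext fun i => ?_
  simp only [matCoeff, one_apply_eq_self, rotH_zpowH, AddCircle.coe_zero,
    fourier_eval_zero, one_smul]

theorem star_rotH (θ : ℝ) : star (rotH θ) = rotH (-θ) := by
  refine matCoeff_ext fun i => ?_
  have ho := orthonormal_iff_ite.1 orthonormal_zpowH
  rw [matCoeff_star]
  simp only [matCoeff, rotH_zpowH, inner_smul_right, ho]
  by_cases h : i.1 = i.2
  · rw [if_pos h.symm, if_pos h, h, mul_one, mul_one, fourier_apply, fourier_apply,
      ← Circle.coe_inv_eq_conj, AddCircle.coe_neg, smul_neg, AddCircle.toCircle_neg]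
  · rw [if_neg (Ne.symm h), if_neg h]; simp

/-- `U_θ` as a unitary operator on the Hardy space. -/
def gaugeUnitary (θ : ℝ) : unitary (H2 →L[ℂ] H2) :=
  ⟨rotH θ, by
    rw [Unitary.mem_iff, star_rotH, ← rotH_add, ← rotH_add]
    simp [rotH_zero]⟩

theorem gaugeUnitary_zpow (θ : ℝ) (n : ℤ) : gaugeUnitary θ ^ n = gaugeUnitary (n • θ) := by
  let f : Multiplicative ℝ →* unitary (H2 →L[ℂ] H2) :=
    { toFun := fun x => gaugeUnitary x.toAdd
      map_one' := Subtype.ext rotH_zero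
      map_mul' := fun x y => Subtype.ext (rotH_add x.toAdd y.toAdd) }
  exact (map_zpow f (Multiplicative.ofAdd θ) n).symm

theorem matCoeff_conj (φ : ℝ) (S : H2 →L[ℂ] H2) (i : ℕ × ℕ) :
    matCoeff (Unitary.conjStarAlgAut ℂ (H2 →L[ℂ] H2) (gaugeUnitary φ) S) i =
      fourier (i.1 : ℤ) (φ : Torus1) * fourier (-(i.2 : ℤ)) (φ : Torus1) * matCoeff S i := by
  rw [Unitary.conjStarAlgAut_apply]
  have h1 : (gaugeUnitary φ : H2 →L[ℂ] H2) = star (rotH (-φ)) := by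
    rw [star_rotH, neg_neg]; rfl
  have h2 : star (gaugeUnitary φ : H2 →L[ℂ] H2) = rotH (-φ) := star_rotH φ
  have h3 : ∀ n : ℕ, fourier (n : ℤ) ((-φ : ℝ) : Torus1) = fourier (-(n : ℤ)) (φ : Torus1) := by
    intro n
    rw [fourier_apply, fourier_apply, AddCircle.coe_neg, smul_neg, neg_smul]
  rw [h2, h1]
  simp only [matCoeff, mul_apply_eq_comp, ContinuousLinearMap.star_eq_adjoint,
    ContinuousLinearMap.adjoint_inner_right, rotH_zpowH, map_smul, inner_smul_left,
    inner_smul_right, h3, ← fourier_neg, neg_neg]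
  ring

theorem RapidDecay.matCoeff_conj {S : H2 →L[ℂ] H2} (hS : RapidDecay (matCoeff S)) (φ : ℝ) :
    RapidDecay (matCoeff (Unitary.conjStarAlgAut ℂ (H2 →L[ℂ] H2) (gaugeUnitary φ) S)) :=
  hS.of_le 0 1 fun i => by
    rw [SmoothCompacts.matCoeff_conj, norm_mul, norm_mul, norm_fourier, norm_fourier]; simp

/-- The `n`-th power of the gauge automorphism `α_θ (S) = U_θ S U_θ^*` of `K^∞`. -/
def gaugeAction (θ : ℝ) (n : ℤ) (S : KInf) : KInf :=
  ⟨Unitary.conjStarAlgAut ℂ (H2 →L[ℂ] H2) (gaugeUnitary θ ^ n) S.op, by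
    rw [gaugeUnitary_zpow]
    exact isSmoothCompact_iff.2 (S.rapidDecay.matCoeff_conj _)⟩

theorem gaugeAction_zero (θ : ℝ) (S : KInf) : gaugeAction θ 0 S = S :=
  KInf.ext_op (by simp [gaugeAction, KInf.op])

theorem gaugeAction_gaugeAction (θ : ℝ) (m n : ℤ) (S : KInf) :
    gaugeAction θ m (gaugeAction θ n S) = gaugeAction θ (m + n) S :=
  KInf.ext_op (by simp only [gaugeAction, KInf.op, zpow_add, map_mul]; rfl)

theorem gaugeAction_add (θ : ℝ) (n : ℤ) (S R : KInf) :
    gaugeAction θ n (S + R) = gaugeAction θ n S + gaugeAction θ n R :=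
  KInf.ext_op (map_add (Unitary.conjStarAlgAut ℂ (H2 →L[ℂ] H2) (gaugeUnitary θ ^ n)) _ _)

theorem gaugeAction_map_zero (θ : ℝ) (n : ℤ) : gaugeAction θ n 0 = 0 :=
  KInf.ext_op (map_zero (Unitary.conjStarAlgAut ℂ (H2 →L[ℂ] H2) (gaugeUnitary θ ^ n)) )

theorem gaugeAction_mul (θ : ℝ) (n : ℤ) (S R : KInf) :
    gaugeAction θ n (S * R) = gaugeAction θ n S * gaugeAction θ n R :=
  KInf.ext_op (map_mul (Unitary.conjStarAlgAut ℂ (H2 →L[ℂ] H2) (gaugeUnitary θ ^ n)) _ _)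

theorem gaugeAction_smul (θ : ℝ) (n : ℤ) (a : ℂ) (S : KInf) :
    gaugeAction θ n (a • S) = a • gaugeAction θ n S :=
  KInf.ext_op (map_smul (Unitary.conjStarAlgAut ℂ (H2 →L[ℂ] H2) (gaugeUnitary θ ^ n)) _ _)

theorem gaugeAction_star (θ : ℝ) (n : ℤ) (S : KInf) :
    gaugeAction θ n (star S) = star (gaugeAction θ n S) :=
  KInf.ext_op (by exact map_star (Unitary.conjStarAlgAut ℂ (H2 →L[ℂ] H2) (gaugeUnitary θ ^ n)) _)

theorem kernelSeminorm_gaugeAction (θ : ℝ) (n : ℤ) (i : ℕ × ℕ) (S : KInf) :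
    kernelSeminorm i (gaugeAction θ n S) = kernelSeminorm i S := by
  set φ : ℝ := n • θ with hφ
  have hg : (gaugeAction θ n S).op =
      Unitary.conjStarAlgAut ℂ (H2 →L[ℂ] H2) (gaugeUnitary φ) S.op := by
    rw [hφ, ← gaugeUnitary_zpow]; rfl
  rw [kernelSeminorm_eq, kernelSeminorm_eq, hg,
    ← (Equiv.addRight ((φ : Torus1), (φ : Torus1))).iSup_comp
      (g := fun p => ‖kernelSeries (dMat i.1 i.2 (matCoeff S.op)) p‖)]
  congr 1
  funext p
  congr 1
  simp only [kernelSeries, Equiv.coe_addRight, Prod.fst_add, Prod.snd_add]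
  refine tsum_congr fun j => ?_
  have h : ∀ (n : ℤ) (x y : Torus1), fourier n (x + y) = fourier n x * fourier n y := by
    intro n x y
    rw [fourier_apply, fourier_apply, fourier_apply, smul_add, AddCircle.toCircle_add]
    push_cast; rfl
  simp only [dMat, matCoeff_conj, h]
  ring

/-! ### Topologies defined by seminorms -/

/-- The uniform structure (hence topology) defined by a family of seminorms. -/
@[reducible] def seminormUniformSpace {E ι : Type*} [AddCommGroup E] [Module ℂ E] (p : ι → Seminorm ℂ E) :
    UniformSpace E :=
  ⨅ i, (p i).toSeminormedAddCommGroup.toUniformSpace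

theorem isUniformAddGroup_seminorm {E ι : Type*} [AddCommGroup E] [Module ℂ E]
    (p : ι → Seminorm ℂ E) : @IsUniformAddGroup E (seminormUniformSpace p) _ :=
  isUniformAddGroup_iInf fun i => by
    let := (p i).toSeminormedAddCommGroup
    infer_instance

theorem withSeminorms_seminorm {E ι : Type*} [AddCommGroup E] [Module ℂ E] [Nonempty ι]
    (p : SeminormFamily ℂ E ι) :
    @WithSeminorms ℂ E ι _ _ _ p (seminormUniformSpace p).toTopologicalSpace := by
  let := seminormUniformSpace p
  have := isUniformAddGroup_seminorm p
  exact p.withSeminorms_iff_uniformSpace_eq_iInf.2 rfl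

theorem continuousMul_of_seminorms {A ι : Type*} [NonUnitalNonAssocRing A] [Module ℂ A]
    [TopologicalSpace A] [IsTopologicalAddGroup A] {p : SeminormFamily ℂ A ι}
    (hp : WithSeminorms p)
    (h : ∀ i, ∃ (C : ℝ) (q r : Seminorm ℂ A), Continuous q ∧ Continuous r ∧
      ∀ x y, p i (x * y) ≤ C * (q x * r y)) : ContinuousMul A := by
  refine ⟨continuous_iff_continuousAt.2 fun ⟨x, y⟩ => ?_⟩
  rw [ContinuousAt, hp.tendsto_nhds]
  intro i ε hε
  obtain ⟨C, q, r, hq, hr, hC⟩ := h i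
  have ht : Tendsto (fun z : A × A =>
      C * (q (z.1 - x) * r (z.2 - y)) + C * (q x * r (z.2 - y)) + C * (q (z.1 - x) * r y))
      (𝓝 (x, y)) (𝓝 0) := by
    have hc : Continuous (fun z : A × A =>
      C * (q (z.1 - x) * r (z.2 - y)) + C * (q x * r (z.2 - y)) + C * (q (z.1 - x) * r y)) := by
      fun_prop
    have := hc.tendsto (x, y)
    simpa using this
  filter_upwards [ht.eventually_lt_const hε] with z hz
  refine lt_of_le_of_lt ?_ hz
  have e : z.1 * z.2 - x * y = (z.1 - x) * (z.2 - y) + x * (z.2 - y) + (z.1 - x) * y := by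
    noncomm_ring
  rw [e]
  refine (map_add_le_add _ _ _).trans (add_le_add ?_ (hC _ _))
  exact (map_add_le_add _ _ _).trans (add_le_add (hC _ _) (hC _ _))

theorem continuousStar_of_seminorms {A ι : Type*} [AddCommGroup A] [Module ℂ A]
    [StarAddMonoid A] [TopologicalSpace A] [IsTopologicalAddGroup A] {p : SeminormFamily ℂ A ι}
    (hp : WithSeminorms p)
    (h : ∀ i, ∃ q : Seminorm ℂ A, Continuous q ∧ ∀ x, p i (star x) ≤ q x) :
    ContinuousStar A := by
  refine ⟨continuous_iff_continuousAt.2 fun x => ?_⟩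
  rw [ContinuousAt, hp.tendsto_nhds]
  intro i ε hε
  obtain ⟨q, hq, hC⟩ := h i
  have ht : Tendsto (fun z : A => q (z - x)) (𝓝 x) (𝓝 0) := by
    have hc : Continuous (fun z : A => q (z - x)) := by fun_prop
    have := hc.tendsto x
    simpa using this
  filter_upwards [ht.eventually_lt_const hε] with z hz
  refine lt_of_le_of_lt ?_ hz
  rw [← star_sub]
  exact hC _

/-! ### The Fréchet algebra `C^∞(T)` -/

/-- The algebra of smooth functions on the circle. -/
def smoothFunctions : StarSubalgebra ℂ (Torus1 → ℂ) where
  carrier := {f | IsSmooth1 f}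
  mul_mem' {f g} hf hg := by
    have h1 : IsSmooth1 f := hf
    have h2 : IsSmooth1 g := hg
    exact ContDiff.mul h1 h2
  add_mem' {f g} hf hg := by
    have h1 : IsSmooth1 f := hf
    have h2 : IsSmooth1 g := hg
    exact ContDiff.add h1 h2
  algebraMap_mem' a := by
    have h : ContDiff ℝ ∞ (fun _ : ℝ => a) := contDiff_const
    exact h
  star_mem' {f} hf := by
    have h1 : IsSmooth1 f := hf
    exact Complex.conjCLE.contDiff.comp h1

/-- The underlying type of `C^∞(T)`. -/
def CInf : Type := smoothFunctions

namespace CInf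

instance : CommRing CInf := inferInstanceAs (CommRing smoothFunctions)
instance : Algebra ℂ CInf := inferInstanceAs (Algebra ℂ smoothFunctions)
instance : StarRing CInf := inferInstanceAs (StarRing smoothFunctions)
instance : StarModule ℂ CInf := inferInstanceAs (StarModule ℂ smoothFunctions)

/-- The function on the circle given by an element of `C^∞(T)`. -/
def fn (f : CInf) : Torus1 → ℂ := f.1

theorem isSmooth1 (f : CInf) : IsSmooth1 f.fn := f.2

theorem bddAbove (f : CInf) (k : ℕ) : BddAbove (Set.range fun t => ‖circleDeriv^[k] f.fn t‖) :=
  bddAbove_norm (f.isSmooth1.iterate k).continuous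

end CInf

theorem circleDeriv_add {f g : Torus1 → ℂ} (hf : IsSmooth1 f) (hg : IsSmooth1 g) :
    circleDeriv (f + g) = circleDeriv f + circleDeriv g :=
  circleDeriv_eq fun x => (hf.hasDerivAt x).add (hg.hasDerivAt x)

theorem circleDeriv_mul {f g : Torus1 → ℂ} (hf : IsSmooth1 f) (hg : IsSmooth1 g) :
    circleDeriv (f * g) = circleDeriv f * g + f * circleDeriv g :=
  circleDeriv_eq fun x => (hf.hasDerivAt x).mul (hg.hasDerivAt x)

theorem circleDeriv_smul (a : ℂ) {f : Torus1 → ℂ} (hf : IsSmooth1 f) :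
    circleDeriv (a • f) = a • circleDeriv f :=
  circleDeriv_eq fun x => (hf.hasDerivAt x).const_smul a

theorem circleDeriv_star {f : Torus1 → ℂ} (hf : IsSmooth1 f) :
    circleDeriv (star f) = star (circleDeriv f) :=
  circleDeriv_eq fun x => (hf.hasDerivAt x).star

theorem circleDeriv_iterate_add {f g : Torus1 → ℂ} (hf : IsSmooth1 f) (hg : IsSmooth1 g) (k : ℕ) :
    circleDeriv^[k] (f + g) = circleDeriv^[k] f + circleDeriv^[k] g := by
  induction k with
  | zero => rfl
  | succ k ih =>
    simp only [Function.iterate_succ_apply', ih, circleDeriv_add (hf.iterate k) (hg.iterate k)]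

theorem circleDeriv_iterate_smul (a : ℂ) {f : Torus1 → ℂ} (hf : IsSmooth1 f) (k : ℕ) :
    circleDeriv^[k] (a • f) = a • circleDeriv^[k] f := by
  induction k with
  | zero => rfl
  | succ k ih => simp only [Function.iterate_succ_apply', ih, circleDeriv_smul a (hf.iterate k)]

theorem circleDeriv_iterate_star {f : Torus1 → ℂ} (hf : IsSmooth1 f) (k : ℕ) :
    circleDeriv^[k] (star f) = star (circleDeriv^[k] f) := by
  induction k with
  | zero => rfl
  | succ k ih => simp only [Function.iterate_succ_apply', ih, circleDeriv_star (hf.iterate k)]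

/-- The seminorm `‖f‖_k = sup |f^{(k)}|` on `C^∞(T)`. -/
def derivSeminorm (k : ℕ) : Seminorm ℂ CInf :=
  Seminorm.of (fun f => ⨆ t, ‖circleDeriv^[k] f.fn t‖)
    (fun f g => by
      refine ciSup_le fun t => ?_
      have h := circleDeriv_iterate_add f.isSmooth1 g.isSmooth1 k
      change ‖circleDeriv^[k] (f.fn + g.fn) t‖ ≤ _
      rw [h]
      exact (norm_add_le _ _).trans
        (add_le_add (le_ciSup (f.bddAbove k) t) (le_ciSup (g.bddAbove k) t)))
    (fun a f => by
      change ⨆ t, ‖circleDeriv^[k] (a • f.fn) t‖ = _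
      simp only [circleDeriv_iterate_smul a f.isSmooth1 k, Pi.smul_apply, norm_smul]
      rw [Real.mul_iSup_of_nonneg (norm_nonneg a)])

theorem norm_iterate_le (f : CInf) (k : ℕ) (t : Torus1) :
    ‖circleDeriv^[k] f.fn t‖ ≤ derivSeminorm k f := le_ciSup (f.bddAbove k) t

/-- The seminorm `max_{k ≤ M} ‖f‖_k` on `C^∞(T)`. -/
def maxDerivSeminorm (M : ℕ) : Seminorm ℂ CInf := (Finset.range (M + 1)).sup derivSeminorm

theorem derivSeminorm_le_max {k M : ℕ} (h : k ≤ M) (f : CInf) :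
    derivSeminorm k f ≤ maxDerivSeminorm M f :=
  Seminorm.le_finset_sup_apply (Finset.mem_range.2 (by omega))

theorem maxDerivSeminorm_mono {k M : ℕ} (h : k ≤ M) (f : CInf) :
    maxDerivSeminorm k f ≤ maxDerivSeminorm M f :=
  Seminorm.finset_sup_apply_le (apply_nonneg _ _) fun j hj =>
    derivSeminorm_le_max (by have := Finset.mem_range.1 hj; omega) f

/-- Differentiation on `C^∞(T)`. -/
def CInf.deriv (f : CInf) : CInf := ⟨circleDeriv f.fn, f.isSmooth1.circleDeriv⟩

theorem derivSeminorm_deriv (k : ℕ) (f : CInf) :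
    derivSeminorm k f.deriv = derivSeminorm (k + 1) f := rfl

theorem maxDerivSeminorm_deriv (k : ℕ) (f : CInf) :
    maxDerivSeminorm k f.deriv ≤ maxDerivSeminorm (k + 1) f :=
  Seminorm.finset_sup_apply_le (apply_nonneg _ _) fun j hj => by
    rw [derivSeminorm_deriv]
    exact derivSeminorm_le_max (by have := Finset.mem_range.1 hj; omega) f

theorem derivSeminorm_mul_le (k : ℕ) (f g : CInf) :
    derivSeminorm k (f * g) ≤ 2 ^ k * (maxDerivSeminorm k f * maxDerivSeminorm k g) := by
  induction k generalizing f g with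
  | zero =>
    rw [pow_zero, one_mul]
    refine ciSup_le fun t => ?_
    change ‖f.fn t * g.fn t‖ ≤ _
    rw [norm_mul]
    exact mul_le_mul ((norm_iterate_le f 0 t).trans (derivSeminorm_le_max le_rfl f))
      ((norm_iterate_le g 0 t).trans (derivSeminorm_le_max le_rfl g)) (norm_nonneg _)
      (apply_nonneg _ _)
  | succ k ih =>
    have e : (f * g).deriv = f.deriv * g + f * g.deriv :=
      Subtype.ext (circleDeriv_mul f.isSmooth1 g.isSmooth1)
    rw [← derivSeminorm_deriv, e]
    refine (map_add_le_add _ _ _).trans ((add_le_add (ih _ _) (ih _ _)).trans ?_)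
    have a1 := maxDerivSeminorm_deriv k f
    have a2 := maxDerivSeminorm_deriv k g
    have a3 := maxDerivSeminorm_mono (Nat.le_succ k) f
    have a4 := maxDerivSeminorm_mono (Nat.le_succ k) g
    have b1 : maxDerivSeminorm k f.deriv * maxDerivSeminorm k g ≤
        maxDerivSeminorm (k + 1) f * maxDerivSeminorm (k + 1) g :=
      mul_le_mul a1 a4 (apply_nonneg _ _) (apply_nonneg _ _)
    have b2 : maxDerivSeminorm k f * maxDerivSeminorm k g.deriv ≤
        maxDerivSeminorm (k + 1) f * maxDerivSeminorm (k + 1) g :=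
      mul_le_mul a3 a2 (apply_nonneg _ _) (apply_nonneg _ _)
    rw [← mul_add, pow_succ, mul_assoc]
    gcongr
    linarith

theorem maxDerivSeminorm_mul_le (M : ℕ) (f g : CInf) :
    maxDerivSeminorm M (f * g) ≤ 2 ^ M * (maxDerivSeminorm M f * maxDerivSeminorm M g) := by
  have h1 := apply_nonneg (maxDerivSeminorm M) f
  have h2 := apply_nonneg (maxDerivSeminorm M) g
  refine Seminorm.finset_sup_apply_le (by positivity) fun k hk => ?_
  have hkM : k ≤ M := by have := Finset.mem_range.1 hk; omega
  refine (derivSeminorm_mul_le k f g).trans ?_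
  have h3 := maxDerivSeminorm_mono hkM f
  have h4 := maxDerivSeminorm_mono hkM g
  have h5 : (2 : ℝ) ^ k ≤ 2 ^ M := pow_le_pow_right₀ one_le_two hkM
  exact mul_le_mul h5 (mul_le_mul h3 h4 (apply_nonneg _ _) h1)
    (mul_nonneg (apply_nonneg _ _) (apply_nonneg _ _)) (by positivity)

theorem maxDerivSeminorm_star_le (M : ℕ) (f : CInf) :
    maxDerivSeminorm M (star f) ≤ maxDerivSeminorm M f :=
  Seminorm.finset_sup_apply_le (apply_nonneg _ _) fun k hk => by
    have hkM : k ≤ M := by have := Finset.mem_range.1 hk; omega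
    refine le_trans (ciSup_le fun t => ?_)
      (derivSeminorm_le_max hkM f)
    change ‖circleDeriv^[k] (star f.fn) t‖ ≤ _
    rw [circleDeriv_iterate_star f.isSmooth1, Pi.star_apply, norm_star]
    exact norm_iterate_le f k t

/-- The seminorm `max_{l, m ≤ N} ‖S‖_{l, m}` on `K^∞`. -/
def maxKernelSeminorm (N : ℕ) : Seminorm ℂ KInf :=
  (Finset.range (N + 1) ×ˢ Finset.range (N + 1)).sup kernelSeminorm

theorem kernelSeminorm_le_max {l m N : ℕ} (hl : l ≤ N) (hm : m ≤ N) (S : KInf) :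
    kernelSeminorm (l, m) S ≤ maxKernelSeminorm N S :=
  Seminorm.le_finset_sup_apply (p := kernelSeminorm) (i := (l, m))
    (s := Finset.range (N + 1) ×ˢ Finset.range (N + 1)) (by simp only [Finset.mem_product, Finset.mem_range]; omega)

theorem maxKernelSeminorm_le {N : ℕ} {S : KInf} {C : ℝ} (hC : 0 ≤ C)
    (h : ∀ l m, l ≤ N → m ≤ N → kernelSeminorm (l, m) S ≤ C) : maxKernelSeminorm N S ≤ C :=
  Seminorm.finset_sup_apply_le hC fun i hi => by
    simp only [Finset.mem_product, Finset.mem_range] at hi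
    exact h i.1 i.2 (by omega) (by omega)

theorem maxKernelSeminorm_mul_le (N : ℕ) (S R : KInf) :
    maxKernelSeminorm N (S * R) ≤ maxKernelSeminorm N S * maxKernelSeminorm N R :=
  maxKernelSeminorm_le (mul_nonneg (apply_nonneg _ _) (apply_nonneg _ _)) fun l m hl hm =>
    (kernelSeminorm_mul_le l m S R).trans
      (mul_le_mul (kernelSeminorm_le_max hl (Nat.zero_le _) S)
        (kernelSeminorm_le_max (Nat.zero_le _) hm R) (apply_nonneg _ _) (apply_nonneg _ _))

theorem maxKernelSeminorm_star_le (N : ℕ) (S : KInf) :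
    maxKernelSeminorm N (star S) ≤ maxKernelSeminorm N S :=
  maxKernelSeminorm_le (apply_nonneg _ _) fun l m hl hm =>
    (kernelSeminorm_star_le l m S).trans (kernelSeminorm_le_max hm hl S)

/-! ### Completions of topological `*`-algebras -/

/-- The completion of a topological `*`-algebra, with the continuous extensions of the
operations. -/
def AlgCompletion (A : Type*) [UniformSpace A] : Type _ := UniformSpace.Completion A

namespace AlgCompletion

open UniformSpace (Completion)

section
variable {A : Type*} [NonUnitalRing A] [UniformSpace A] [IsUniformAddGroup A]

instance : UniformSpace (AlgCompletion A) := inferInstanceAs (UniformSpace (Completion A))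
instance : CompleteSpace (AlgCompletion A) := inferInstanceAs (CompleteSpace (Completion A))
instance : T0Space (AlgCompletion A) := inferInstanceAs (T0Space (Completion A))
instance : AddCommGroup (AlgCompletion A) := inferInstanceAs (AddCommGroup (Completion A))
instance : IsUniformAddGroup (AlgCompletion A) :=
  inferInstanceAs (IsUniformAddGroup (Completion A))

/-- The canonical map to the completion. -/
def of : A →+ AlgCompletion A := UniformSpace.Completion.toCompl

theorem isDenseInducing_of : IsDenseInducing (of : A → AlgCompletion A) :=
  UniformSpace.Completion.isDenseInducing_coe

theorem continuous_of : Continuous (of : A → AlgCompletion A) := isDenseInducing_of.continuous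

theorem denseRange_of : DenseRange (of : A → AlgCompletion A) := isDenseInducing_of.dense

instance : Mul (AlgCompletion A) :=
  ⟨Function.curry <| (isDenseInducing_of.prodMap isDenseInducing_of).extend
    fun x : A × A => of (x.1 * x.2)⟩

theorem of_mul [ContinuousMul A] (a b : A) : (of (a * b) : AlgCompletion A) = of a * of b :=
  ((isDenseInducing_of.prodMap isDenseInducing_of).extend_eq
    (f := fun x : A × A => (of (x.1 * x.2) : AlgCompletion A))
    (continuous_of.comp continuous_mul) (a, b)).symm

instance [ContinuousMul A] : ContinuousMul (AlgCompletion A) where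
  continuous_mul := by
    let m := (AddMonoidHom.mul : A →+ A →+ A).compr₂ of
    have : Continuous fun p : A × A => m p.1 p.2 := continuous_of.comp continuous_mul
    exact (isDenseInducing_of.extend_Z_bilin isDenseInducing_of this :)

theorem induction₃ {P : AlgCompletion A → AlgCompletion A → AlgCompletion A → Prop}
    (hP : IsClosed {x : AlgCompletion A × AlgCompletion A × AlgCompletion A | P x.1 x.2.1 x.2.2})
    (h : ∀ a b c : A, P (of a) (of b) (of c)) (x y z : AlgCompletion A) : P x y z :=
  Completion.induction_on₃ (α := A) (β := A) (γ := A) x y z hP h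

theorem induction₁ {P : AlgCompletion A → Prop} (hP : IsClosed {x | P x})
    (h : ∀ a : A, P (of a)) (x : AlgCompletion A) : P x :=
  Completion.induction_on (α := A) x hP h

instance [ContinuousMul A] : NonUnitalRing (AlgCompletion A) :=
  { (inferInstance : AddCommGroup (AlgCompletion A)), (inferInstance : Mul (AlgCompletion A)) with
    zero_mul := induction₁ (isClosed_eq (by fun_prop) continuous_const) fun a => by
      rw [← map_zero (of : A →+ AlgCompletion A), ← of_mul, zero_mul]
    mul_zero := induction₁ (isClosed_eq (by fun_prop) continuous_const) fun a => by
      rw [← map_zero (of : A →+ AlgCompletion A), ← of_mul, mul_zero]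
    mul_assoc := induction₃ (isClosed_eq (by fun_prop) (by fun_prop)) fun a b c => by
      rw [← of_mul, ← of_mul, ← of_mul, ← of_mul, mul_assoc]
    left_distrib := induction₃ (isClosed_eq (by fun_prop) (by fun_prop)) fun a b c => by
      rw [← map_add, ← of_mul, ← of_mul, ← of_mul, ← map_add, mul_add]
    right_distrib := induction₃ (isClosed_eq (by fun_prop) (by fun_prop)) fun a b c => by
      rw [← map_add, ← of_mul, ← of_mul, ← of_mul, ← map_add, add_mul] }

variable [Module ℂ A] [UniformContinuousConstSMul ℂ A]

instance : Module ℂ (AlgCompletion A) := inferInstanceAs (Module ℂ (Completion A))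
instance : UniformContinuousConstSMul ℂ (AlgCompletion A) :=
  inferInstanceAs (UniformContinuousConstSMul ℂ (Completion A))

theorem of_smul (a : ℂ) (x : A) : (of (a • x) : AlgCompletion A) = a • of x :=
  UniformSpace.Completion.coe_smul a x

instance [ContinuousMul A] [IsScalarTower ℂ A A] :
    IsScalarTower ℂ (AlgCompletion A) (AlgCompletion A) :=
  ⟨fun a x y => induction₃ (P := fun x y _ => (a • x) * y = a • (x * y))
    (isClosed_eq ((continuous_fst.const_smul a).mul continuous_snd.fst)
      ((continuous_fst.mul continuous_snd.fst).const_smul a))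
    (fun x y _ => by
      rw [← of_smul, ← of_mul, ← of_mul, ← of_smul, smul_mul_assoc]) x y 0⟩

instance [ContinuousMul A] [SMulCommClass ℂ A A] :
    SMulCommClass ℂ (AlgCompletion A) (AlgCompletion A) :=
  ⟨fun a x y => induction₃ (P := fun x y _ => a • (x * y) = x * (a • y))
    (isClosed_eq ((continuous_fst.mul continuous_snd.fst).const_smul a)
      (continuous_fst.mul (continuous_snd.fst.const_smul a)))
    (fun x y _ => by
      rw [← of_smul, ← of_mul, ← of_mul, ← of_smul, mul_smul_comm]) x y 0⟩

end

section
variable {A : Type*} [NonUnitalRing A] [UniformSpace A] [IsUniformAddGroup A]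
  [StarRing A]

instance : Star (AlgCompletion A) := ⟨UniformSpace.Completion.map (star : A → A)⟩

variable [ContinuousStar A]

theorem uniformContinuous_star' : UniformContinuous (star : A → A) :=
  uniformContinuous_addMonoidHom_of_continuous (f := (starAddEquiv : A ≃+ A).toAddMonoidHom)
    continuous_star

theorem of_star (a : A) : (of (star a) : AlgCompletion A) = star (of a) :=
  (UniformSpace.Completion.map_coe uniformContinuous_star' a).symm

instance : ContinuousStar (AlgCompletion A) := ⟨UniformSpace.Completion.continuous_map⟩

instance [ContinuousMul A] : StarRing (AlgCompletion A) where
  star_involutive := induction₁ (isClosed_eq (by fun_prop) continuous_id) fun a => by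
    rw [← of_star, ← of_star, star_star]
  star_mul x y := induction₃ (P := fun x y _ => star (x * y) = star y * star x)
    (isClosed_eq (by fun_prop) (by fun_prop)) (fun a b _ => by
      rw [← of_mul, ← of_star, ← of_star, ← of_star, ← of_mul, star_mul]) x y 0
  star_add x y := induction₃ (P := fun x y _ => star (x + y) = star x + star y)
    (isClosed_eq (by fun_prop) (by fun_prop)) (fun a b _ => by
      rw [← map_add, ← of_star, ← of_star, ← of_star, ← map_add, star_add]) x y 0

end

end AlgCompletion

/-! ### The crossed product -/

/-- The `*`-algebra `K^∞[ℤ]` of finite sums `∑ A_n U_θ ^ n` with coefficients `A_n` in `K^∞`. -/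
def CrossedAlg (_θ : ℝ) : Type := ℤ →₀ KInf

namespace CrossedAlg

variable (θ : ℝ)

instance : AddCommGroup (CrossedAlg θ) := inferInstanceAs (AddCommGroup (ℤ →₀ KInf))
instance : Module ℂ (CrossedAlg θ) := inferInstanceAs (Module ℂ (ℤ →₀ KInf))

/-- The coefficients `A_n` of `∑ A_n U_θ ^ n`. -/
def coeffs {θ : ℝ} (f : CrossedAlg θ) : ℤ →₀ KInf := f

/-- The product determined by `(A U_θ ^ m) (B U_θ ^ n) = A α_θ ^ m (B) U_θ ^ (m + n)`. -/
def crossMul (f g : ℤ →₀ KInf) : ℤ →₀ KInf :=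
  f.sum fun m A => g.sum fun n B => Finsupp.single (m + n) (A * gaugeAction θ m B)

/-- The involution determined by `(A U_θ ^ n)^* = α_θ ^ (-n) (A^*) U_θ ^ (-n)`. -/
def crossStar (f : ℤ →₀ KInf) : ℤ →₀ KInf :=
  f.sum fun n A => Finsupp.single (-n) (gaugeAction θ (-n) (star A))

theorem crossMul_add_left (f f' g : ℤ →₀ KInf) :
    crossMul θ (f + f') g = crossMul θ f g + crossMul θ f' g := by
  refine Finsupp.sum_add_index' (fun m => ?_) (fun m A B => ?_)
  · simp
  · simp only [add_mul, Finsupp.single_add, Finsupp.sum_add]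

theorem crossMul_add_right (f g g' : ℤ →₀ KInf) :
    crossMul θ f (g + g') = crossMul θ f g + crossMul θ f g' := by
  rw [crossMul, crossMul, crossMul, ← Finsupp.sum_add]
  refine Finsupp.sum_congr fun m _ => Finsupp.sum_add_index' (fun n => ?_) (fun n A B => ?_)
  · simp [gaugeAction_map_zero]
  · simp only [gaugeAction_add, mul_add, Finsupp.single_add]

theorem crossMul_zero_left (g : ℤ →₀ KInf) : crossMul θ 0 g = 0 := Finsupp.sum_zero_index

theorem crossMul_zero_right (f : ℤ →₀ KInf) : crossMul θ f 0 = 0 := by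
  simp [crossMul, Finsupp.sum_zero_index]

theorem crossMul_single (m n : ℤ) (A B : KInf) :
    crossMul θ (Finsupp.single m A) (Finsupp.single n B) =
      Finsupp.single (m + n) (A * gaugeAction θ m B) := by
  rw [crossMul, Finsupp.sum_single_index, Finsupp.sum_single_index]
  · simp [gaugeAction_map_zero]
  · simp

theorem crossMul_assoc (f g h : ℤ →₀ KInf) :
    crossMul θ (crossMul θ f g) h = crossMul θ f (crossMul θ g h) := by
  induction f using Finsupp.induction_linear with
  | zero => simp only [crossMul_zero_left]
  | add f f' hf hf' => simp only [crossMul_add_left, hf, hf']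
  | single m A =>
    induction g using Finsupp.induction_linear with
    | zero => simp only [crossMul_zero_left, crossMul_zero_right]
    | add g g' hg hg' => simp only [crossMul_add_left, crossMul_add_right, hg, hg']
    | single n B =>
      induction h using Finsupp.induction_linear with
      | zero => simp only [crossMul_zero_right]
      | add h h' hh hh' => simp only [crossMul_add_right, hh, hh']
      | single k C =>
        simp only [crossMul_single, gaugeAction_mul, gaugeAction_gaugeAction, mul_assoc, add_assoc]

theorem crossStar_add (f g : ℤ →₀ KInf) :
    crossStar θ (f + g) = crossStar θ f + crossStar θ g := by
  refine Finsupp.sum_add_index' (fun n => ?_) (fun n A B => ?_)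
  · simp [gaugeAction_map_zero]
  · simp only [star_add, gaugeAction_add, Finsupp.single_add]

theorem crossStar_single (n : ℤ) (A : KInf) :
    crossStar θ (Finsupp.single n A) = Finsupp.single (-n) (gaugeAction θ (-n) (star A)) :=
  Finsupp.sum_single_index (by simp [gaugeAction_map_zero])

theorem crossStar_zero : crossStar θ 0 = 0 := Finsupp.sum_zero_index

theorem crossStar_crossStar (f : ℤ →₀ KInf) : crossStar θ (crossStar θ f) = f := by
  induction f using Finsupp.induction_linear with
  | zero => simp only [crossStar_zero]
  | add f g hf hg => simp only [crossStar_add, hf, hg]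
  | single n A =>
    simp only [crossStar_single, ← gaugeAction_star, gaugeAction_gaugeAction, star_star, neg_neg,
      add_neg_cancel, gaugeAction_zero]

theorem crossStar_crossMul (f g : ℤ →₀ KInf) :
    crossStar θ (crossMul θ f g) = crossMul θ (crossStar θ g) (crossStar θ f) := by
  induction f using Finsupp.induction_linear with
  | zero => simp only [crossStar_zero, crossMul_zero_left, crossMul_zero_right]
  | add f f' hf hf' => simp only [crossStar_add, crossMul_add_left, crossMul_add_right, hf, hf']
  | single m A =>
    induction g using Finsupp.induction_linear with
    | zero => simp only [crossStar_zero, crossMul_zero_left, crossMul_zero_right]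
    | add g g' hg hg' => simp only [crossStar_add, crossMul_add_left, crossMul_add_right, hg, hg']
    | single n B =>
      simp only [crossMul_single, crossStar_single, star_mul, gaugeAction_mul, ← gaugeAction_star,
        gaugeAction_gaugeAction, neg_add_rev, neg_add_cancel_right]

instance : NonUnitalRing (CrossedAlg θ) :=
  { (inferInstance : AddCommGroup (CrossedAlg θ)) with
    mul := crossMul θ
    left_distrib := crossMul_add_right θ
    right_distrib := crossMul_add_left θ
    zero_mul := crossMul_zero_left θ
    mul_zero := crossMul_zero_right θ
    mul_assoc := crossMul_assoc θ }

instance : StarRing (CrossedAlg θ) where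
  star := crossStar θ
  star_involutive := crossStar_crossStar θ
  star_mul := crossStar_crossMul θ
  star_add := crossStar_add θ

theorem crossMul_smul_left (a : ℂ) (f g : ℤ →₀ KInf) :
    crossMul θ (a • f) g = a • crossMul θ f g := by
  rw [crossMul, crossMul, Finsupp.sum_smul_index' (fun m => by simp), Finsupp.smul_sum]
  refine Finsupp.sum_congr fun m _ => ?_
  rw [Finsupp.smul_sum]
  refine Finsupp.sum_congr fun n _ => ?_
  rw [smul_mul_assoc, Finsupp.smul_single]

theorem crossMul_smul_right (a : ℂ) (f g : ℤ →₀ KInf) :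
    crossMul θ f (a • g) = a • crossMul θ f g := by
  rw [crossMul, crossMul, Finsupp.smul_sum]
  refine Finsupp.sum_congr fun m _ => ?_
  rw [Finsupp.sum_smul_index' (fun n => by simp [gaugeAction_map_zero]), Finsupp.smul_sum]
  refine Finsupp.sum_congr fun n _ => ?_
  rw [gaugeAction_smul, mul_smul_comm, Finsupp.smul_single]

instance : IsScalarTower ℂ (CrossedAlg θ) (CrossedAlg θ) := ⟨crossMul_smul_left θ⟩
instance : SMulCommClass ℂ (CrossedAlg θ) (CrossedAlg θ) :=
  ⟨fun a f g => (crossMul_smul_right θ a f g).symm⟩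

theorem crossMul_apply (f g : ℤ →₀ KInf) (n : ℤ) :
    crossMul θ f g n = ∑ m ∈ f.support, f m * gaugeAction θ m (g (n - m)) := by
  rw [crossMul, Finsupp.sum, Finsupp.finsetSum_apply]
  refine Finset.sum_congr rfl fun m _ => ?_
  rw [Finsupp.sum, Finsupp.finsetSum_apply, Finset.sum_eq_single (n - m)]
  · rw [show m + (n - m) = n by ring, Finsupp.single_eq_same]
  · intro k _ hk
    exact Finsupp.single_eq_of_ne (by omega)
  · intro h
    rw [Finsupp.notMem_support_iff.1 h, gaugeAction_map_zero, mul_zero, Finsupp.single_zero]; rfl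

theorem bddAbove_weighted (q : Seminorm ℂ KInf) (w : ℤ → ℝ) (f : ℤ →₀ KInf) :
    BddAbove (Set.range fun n => w n * q (f n)) := by
  refine ((f.support.finite_toSet.image fun n => w n * q (f n)).insert 0).bddAbove.mono ?_
  rintro _ ⟨n, rfl⟩
  by_cases h : n ∈ f.support
  · exact Or.inr ⟨n, h, rfl⟩
  · left; simp [Finsupp.notMem_support_iff.1 h]

/-- The seminorm `sup_n (1 + |n| ^ 2) ^ p ‖A_n‖_{l, m}` of `∑ A_n U_θ ^ n`. -/
def crossedSeminorm (i : ℕ × ℕ × ℕ) : Seminorm ℂ (CrossedAlg θ) :=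
  Seminorm.of
    (fun f => ⨆ n : ℤ, (1 + (|n| : ℝ) ^ 2) ^ i.1 * kernelSeminorm i.2 (f.coeffs n))
    (fun f g => by
      refine ciSup_le fun n => ?_
      refine le_trans ?_ (add_le_add
        (le_ciSup (bddAbove_weighted (kernelSeminorm i.2) (fun n => (1 + (|n| : ℝ) ^ 2) ^ i.1) f.coeffs) n)
        (le_ciSup (bddAbove_weighted (kernelSeminorm i.2) (fun n => (1 + (|n| : ℝ) ^ 2) ^ i.1) g.coeffs) n))
      rw [← mul_add]
      gcongr
      exact map_add_le_add _ _ _)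
    (fun a f => by
      change ⨆ n : ℤ, (1 + (|n| : ℝ) ^ 2) ^ i.1 * kernelSeminorm i.2 (a • f.coeffs n) = _
      simp only [map_smul_eq_mul]
      rw [Real.mul_iSup_of_nonneg (norm_nonneg a)]
      congr 1; funext n; ring)

theorem le_crossedSeminorm (p : ℕ) (j : ℕ × ℕ) (f : CrossedAlg θ) (n : ℤ) :
    (1 + (|n| : ℝ) ^ 2) ^ p * kernelSeminorm j (f.coeffs n) ≤ crossedSeminorm θ (p, j) f :=
  le_ciSup (bddAbove_weighted (kernelSeminorm j) (fun n => (1 + (|n| : ℝ) ^ 2) ^ p) f.coeffs) n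

theorem summable_weight : Summable fun n : ℤ => 1 / (1 + (|n| : ℝ) ^ 2) := by
  refine Summable.of_nonneg_of_le (fun n => by positivity) (fun n => ?_)
    ((Real.summable_one_div_int_pow.2 (one_lt_two)).add (summable_of_hasFiniteSupport
      (f := fun n : ℤ => if n = 0 then (1 : ℝ) else 0) ((Set.finite_singleton 0).subset (by
        intro n hn; by_contra h; exact hn (if_neg h)))))
  by_cases h : n = 0
  · simp [h]
  · have : (0 : ℝ) < (n : ℝ) ^ 2 := by positivity
    simp only [h, if_false, add_zero, sq_abs]
    exact one_div_le_one_div_of_le this (by linarith)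

theorem crossedSeminorm_mul_le (p l m : ℕ) (f g : CrossedAlg θ) :
    crossedSeminorm θ (p, l, m) (f * g) ≤ (2 ^ p * ∑' n : ℤ, 1 / (1 + (|n| : ℝ) ^ 2)) *
      (crossedSeminorm θ (p + 1, l, 0) f * crossedSeminorm θ (p, 0, m) g) := by
  refine ciSup_le fun n => ?_
  change (1 + (|n| : ℝ) ^ 2) ^ p * kernelSeminorm (l, m) (crossMul θ f.coeffs g.coeffs n) ≤ _
  rw [crossMul_apply]
  set F := crossedSeminorm θ (p + 1, l, 0) f with hF
  set G := crossedSeminorm θ (p, 0, m) g with hG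
  have hF0 : 0 ≤ F := apply_nonneg _ _
  have hG0 : 0 ≤ G := apply_nonneg _ _
  have hterm : ∀ k : ℤ, (1 + (|n| : ℝ) ^ 2) ^ p *
      kernelSeminorm (l, m) (f.coeffs k * gaugeAction θ k (g.coeffs (n - k))) ≤
        2 ^ p * (1 / (1 + (|k| : ℝ) ^ 2)) * (F * G) := by
    intro k
    have h1 := le_crossedSeminorm θ (p + 1) (l, 0) f k
    have h2 := le_crossedSeminorm θ p (0, m) g (n - k)
    have h3 := kernelSeminorm_mul_le l m (f.coeffs k)
      (gaugeAction θ k (g.coeffs (n - k)))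
    rw [kernelSeminorm_gaugeAction] at h3
    have hw : 1 + (|n| : ℝ) ^ 2 ≤ 2 * ((1 + (|k| : ℝ) ^ 2) * (1 + (|((n - k : ℤ) : ℝ)|) ^ 2)) := by
      simp only [sq_abs]
      push_cast
      nlinarith [sq_nonneg ((k : ℝ) - (n - k)), mul_nonneg (sq_nonneg (k : ℝ)) (sq_nonneg ((n : ℝ) - k))]
    set a := kernelSeminorm (l, 0) (f.coeffs k) with ha
    set b := kernelSeminorm (0, m) (g.coeffs (n - k)) with hb
    have ha0 : 0 ≤ a := apply_nonneg _ _
    have hb0 : 0 ≤ b := apply_nonneg _ _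
    set x := 1 + (|k| : ℝ) ^ 2 with hx
    set y := 1 + (|((n - k : ℤ) : ℝ)|) ^ 2 with hy
    have hx0 : 0 < x := by positivity
    have hy0 : 0 < y := by positivity
    calc (1 + (|n| : ℝ) ^ 2) ^ p * kernelSeminorm (l, m)
          (f.coeffs k * gaugeAction θ k (g.coeffs (n - k)))
        ≤ (2 * (x * y)) ^ p * (a * b) := by gcongr
      _ = 2 ^ p * (1 / x) * ((x ^ (p + 1) * a) * (y ^ p * b)) := by
          rw [mul_pow, mul_pow, pow_succ]; field_simp
      _ ≤ 2 ^ p * (1 / x) * (F * G) := by gcongr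
  calc (1 + (|n| : ℝ) ^ 2) ^ p * kernelSeminorm (l, m) (∑ k ∈ f.coeffs.support,
        f.coeffs k * gaugeAction θ k (g.coeffs (n - k)))
      ≤ (1 + (|n| : ℝ) ^ 2) ^ p * ∑ k ∈ f.coeffs.support, kernelSeminorm (l, m)
        (f.coeffs k * gaugeAction θ k (g.coeffs (n - k))) := by
        gcongr
        exact Finset.le_sum_of_subadditive _ (map_zero _).le (map_add_le_add _) _ _
    _ ≤ ∑ k ∈ f.coeffs.support, 2 ^ p * (1 / (1 + (|k| : ℝ) ^ 2)) * (F * G) := by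
        rw [Finset.mul_sum]
        exact Finset.sum_le_sum fun k _ => hterm k
    _ = (2 ^ p * ∑ k ∈ f.coeffs.support, 1 / (1 + (|k| : ℝ) ^ 2)) * (F * G) := by
        rw [← Finset.sum_mul, Finset.mul_sum]
    _ ≤ _ := by
        gcongr
        exact summable_weight.sum_le_tsum _ fun k _ => by positivity

theorem crossedSeminorm_star_le (p l m : ℕ) (f : CrossedAlg θ) :
    crossedSeminorm θ (p, l, m) (star f) ≤ crossedSeminorm θ (p, m, l) f := by
  refine ciSup_le fun n => ?_
  change (1 + (|n| : ℝ) ^ 2) ^ p * kernelSeminorm (l, m) (crossStar θ f.coeffs n) ≤ _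
  have e : crossStar θ f.coeffs n = gaugeAction θ n (star (f.coeffs (-n))) := by
    generalize f.coeffs = g
    induction g using Finsupp.induction_linear with
    | zero => simp [crossStar_zero, gaugeAction_map_zero]
    | add f g hf hg =>
      rw [crossStar_add, Finsupp.add_apply, Finsupp.add_apply, hf, hg, star_add, gaugeAction_add]
    | single k A =>
      rw [crossStar_single]
      by_cases h : n = -k
      · subst h; simp
      · rw [Finsupp.single_eq_of_ne h, Finsupp.single_eq_of_ne (by omega), star_zero,
          gaugeAction_map_zero]
  rw [e, kernelSeminorm_gaugeAction]
  refine le_trans ?_ (le_crossedSeminorm θ p (m, l) f (-n))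
  have := kernelSeminorm_star_le l m (f.coeffs (-n))
  push_cast
  rw [abs_neg]
  gcongr

instance : UniformSpace (CrossedAlg θ) := seminormUniformSpace (crossedSeminorm θ)

instance : IsUniformAddGroup (CrossedAlg θ) := isUniformAddGroup_seminorm (crossedSeminorm θ)

theorem withSeminorms : WithSeminorms (crossedSeminorm θ) :=
  withSeminorms_seminorm (crossedSeminorm θ)

instance : ContinuousSMul ℂ (CrossedAlg θ) := (withSeminorms θ).continuousSMul

instance : UniformContinuousConstSMul ℂ (CrossedAlg θ) :=
  uniformContinuousConstSMul_of_continuousConstSMul ℂ _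

instance : ContinuousMul (CrossedAlg θ) := continuousMul_of_seminorms (withSeminorms θ) fun i =>
  ⟨_, _, _, (withSeminorms θ).continuous_seminorm _, (withSeminorms θ).continuous_seminorm _,
    crossedSeminorm_mul_le θ i.1 i.2.1 i.2.2⟩

instance : ContinuousStar (CrossedAlg θ) := continuousStar_of_seminorms (withSeminorms θ) fun i =>
  ⟨_, (withSeminorms θ).continuous_seminorm _, crossedSeminorm_star_le θ i.1 i.2.1 i.2.2⟩

end CrossedAlg

/-- The crossed product of `K^∞` by the gauge action `α_θ` of `ℤ`: the completion of `K^∞[ℤ]` for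
the seminorms `sup_n (1 + |n| ^ 2) ^ p ‖A_n‖_{l, m}`. -/
abbrev CrossedProduct (θ : ℝ) : Type := AlgCompletion (CrossedAlg θ)

/-! ### The projective tensor product -/

section ProjectiveSeminorm

variable {E F : Type*} [AddCommGroup E] [Module ℂ E] [AddCommGroup F] [Module ℂ F]

/-- The sums `∑ p (a_j) q (b_j)` over all representations `x = ∑ a_j ⊗ b_j`. -/
def projValues (p : Seminorm ℂ E) (q : Seminorm ℂ F) (x : E ⊗[ℂ] F) : Set ℝ :=
  {r | ∃ (n : ℕ) (a : Fin n → E) (b : Fin n → F),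
    x = ∑ j, a j ⊗ₜ[ℂ] b j ∧ r = ∑ j, p (a j) * q (b j)}

variable (p : Seminorm ℂ E) (q : Seminorm ℂ F)

theorem projValues_bddBelow (x : E ⊗[ℂ] F) : BddBelow (projValues p q x) :=
  ⟨0, by
    rintro _ ⟨n, a, b, -, rfl⟩
    exact Finset.sum_nonneg fun j _ => mul_nonneg (apply_nonneg _ _) (apply_nonneg _ _)⟩

theorem projValues_add {x y : E ⊗[ℂ] F} {r s : ℝ} (hr : r ∈ projValues p q x)
    (hs : s ∈ projValues p q y) : r + s ∈ projValues p q (x + y) := by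
  obtain ⟨n, a, b, rfl, rfl⟩ := hr
  obtain ⟨m, c, d, rfl, rfl⟩ := hs
  exact ⟨n + m, Fin.append a c, Fin.append b d, by simp [Fin.sum_univ_add],
    by simp [Fin.sum_univ_add]⟩

theorem projValues_tmul (a : E) (b : F) : p a * q b ∈ projValues p q (a ⊗ₜ[ℂ] b) :=
  ⟨1, fun _ => a, fun _ => b, by simp, by simp⟩

theorem projValues_zero : (0 : ℝ) ∈ projValues p q (0 : E ⊗[ℂ] F) :=
  ⟨0, Fin.elim0, Fin.elim0, by simp, by simp⟩

theorem projValues_nonempty (x : E ⊗[ℂ] F) : (projValues p q x).Nonempty := by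
  induction x using TensorProduct.induction_on with
  | zero => exact ⟨0, projValues_zero p q⟩
  | tmul a b => exact ⟨_, projValues_tmul p q a b⟩
  | add x y hx hy => exact ⟨_, projValues_add p q hx.some_mem hy.some_mem⟩

theorem projValues_smul {x : E ⊗[ℂ] F} {r : ℝ} (c : ℂ) (hr : r ∈ projValues p q x) :
    ‖c‖ * r ∈ projValues p q (c • x) := by
  obtain ⟨n, a, b, rfl, rfl⟩ := hr
  refine ⟨n, fun j => c • a j, b, ?_, ?_⟩
  · rw [Finset.smul_sum]; simp only [TensorProduct.smul_tmul']
  · rw [Finset.mul_sum]; simp only [map_smul_eq_mul, mul_assoc]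

/-- The projective tensor product of two seminorms: the infimum of `∑ p (a_j) q (b_j)` over all
representations `x = ∑ a_j ⊗ b_j`. -/
def projSeminorm : Seminorm ℂ (E ⊗[ℂ] F) :=
  Seminorm.ofSMulLE (fun x => sInf (projValues p q x))
    (le_antisymm (csInf_le (projValues_bddBelow p q 0) (projValues_zero p q))
      (le_csInf (projValues_nonempty p q 0) (by
        rintro _ ⟨n, a, b, -, rfl⟩
        exact Finset.sum_nonneg fun j _ => mul_nonneg (apply_nonneg _ _) (apply_nonneg _ _))))
    (fun x y => by
      rw [← csInf_add (projValues_nonempty p q x) (projValues_bddBelow p q x)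
        (projValues_nonempty p q y) (projValues_bddBelow p q y)]
      refine csInf_le_csInf (projValues_bddBelow p q _)
        ((projValues_nonempty p q x).add (projValues_nonempty p q y)) ?_
      rintro _ ⟨r, hr, s, hs, rfl⟩
      exact projValues_add p q hr hs)
    (fun c x => by
      rw [← smul_eq_mul, ← Real.sInf_smul_of_nonneg (norm_nonneg c)]
      refine csInf_le_csInf (projValues_bddBelow p q _)
        ((projValues_nonempty p q x).smul_set) ?_
      rintro _ ⟨r, hr, rfl⟩
      exact projValues_smul p q c hr)

theorem projSeminorm_le {x : E ⊗[ℂ] F} {r : ℝ} (hr : r ∈ projValues p q x) :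
    projSeminorm p q x ≤ r := csInf_le (projValues_bddBelow p q x) hr

theorem le_projSeminorm {x : E ⊗[ℂ] F} {C : ℝ} (h : ∀ r ∈ projValues p q x, C ≤ r) :
    C ≤ projSeminorm p q x := le_csInf (projValues_nonempty p q x) h

end ProjectiveSeminorm

/-- The algebraic tensor product of `K^∞` and `C^∞(T)`, a `*`-algebra with
`(a ⊗ b) (c ⊗ d) = a c ⊗ b d` and `(a ⊗ b)^* = a^* ⊗ b^*`. -/
abbrev TensorAlg : Type := KInf ⊗[ℂ] CInf

namespace TensorAlg

instance : StarRing TensorAlg where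
  star_add := star_add
  star_mul x y := by
    induction x using TensorProduct.induction_on with
    | zero => simp
    | add x x' hx hx' => rw [add_mul, star_add, hx, hx', star_add, mul_add]
    | tmul a b =>
      induction y using TensorProduct.induction_on with
      | zero => simp
      | add y y' hy hy' => rw [mul_add, star_add, hy, hy', star_add, add_mul]
      | tmul c d =>
        rw [Algebra.TensorProduct.tmul_mul_tmul, TensorProduct.star_tmul, TensorProduct.star_tmul,
          TensorProduct.star_tmul, Algebra.TensorProduct.tmul_mul_tmul, star_mul, star_mul]

/-- The seminorms `‖x‖_{N, M} = inf ∑ ‖a_j‖_N ‖b_j‖_M` over the representations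
`x = ∑ a_j ⊗ b_j`, where `‖·‖_N` and `‖·‖_M` run through the increasing sequences of seminorms
of `K^∞` and of `C^∞(T)`. -/
def seminorm (i : ℕ × ℕ) : Seminorm ℂ TensorAlg :=
  projSeminorm (maxKernelSeminorm i.1) (maxDerivSeminorm i.2)

theorem seminorm_mul_le (i : ℕ × ℕ) (x y : TensorAlg) :
    seminorm i (x * y) ≤ 2 ^ i.2 * (seminorm i x * seminorm i y) := by
  set P := maxKernelSeminorm i.1 with hP
  set Q := maxDerivSeminorm i.2 with hQ
  have hP0 : ∀ a, 0 ≤ P a := fun a => apply_nonneg _ _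
  have hQ0 : ∀ a, 0 ≤ Q a := fun a => apply_nonneg _ _
  have h1 : ∀ (a : KInf) (b : CInf) (y : TensorAlg),
      seminorm i (a ⊗ₜ[ℂ] b * y) ≤ 2 ^ i.2 * (P a * Q b) * seminorm i y := by
    intro a b y
    have hc : 0 ≤ 2 ^ i.2 * (P a * Q b) := by have := hP0 a; have := hQ0 b; positivity
    have : ∀ r ∈ projValues P Q y, seminorm i (a ⊗ₜ[ℂ] b * y) ≤ 2 ^ i.2 * (P a * Q b) * r := by
      rintro _ ⟨n, c, d, rfl, rfl⟩
      refine le_trans (projSeminorm_le P Q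
        ⟨n, fun j => a * c j, fun j => b * d j, ?_, rfl⟩) ?_
      · rw [Finset.mul_sum]
        simp only [Algebra.TensorProduct.tmul_mul_tmul]
      · rw [Finset.mul_sum]
        refine Finset.sum_le_sum fun j _ => ?_
        have e1 := maxKernelSeminorm_mul_le i.1 a (c j)
        have e2 := maxDerivSeminorm_mul_le i.2 b (d j)
        calc P (a * c j) * Q (b * d j)
            ≤ (P a * P (c j)) * (2 ^ i.2 * (Q b * Q (d j))) :=
              mul_le_mul e1 e2 (hQ0 _) (mul_nonneg (hP0 _) (hP0 _))
          _ = _ := by ring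
    rcases hc.eq_or_lt with h0 | h0
    · obtain ⟨r, hr⟩ := projValues_nonempty P Q y
      have := this r hr
      rw [← h0, zero_mul] at this ⊢
      exact this
    · rw [← div_le_iff₀' h0]
      refine le_projSeminorm P Q fun r hr => ?_
      rw [div_le_iff₀' h0]
      exact this r hr
  have hy0 : 0 ≤ seminorm i y := apply_nonneg _ _
  have h2 : ∀ r ∈ projValues P Q x, seminorm i (x * y) ≤ 2 ^ i.2 * seminorm i y * r := by
    rintro _ ⟨n, a, b, rfl, rfl⟩
    rw [Finset.sum_mul, Finset.mul_sum]
    refine (Finset.le_sum_of_subadditive _ (map_zero _).le (map_add_le_add _) _ _).trans ?_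
    refine Finset.sum_le_sum fun j _ => (h1 _ _ _).trans_eq (by ring)
  have hc : 0 ≤ 2 ^ i.2 * seminorm i y := by positivity
  rcases hc.eq_or_lt with h0 | h0
  · obtain ⟨r, hr⟩ := projValues_nonempty P Q x
    have h3 := h2 r hr
    rw [← h0, zero_mul] at h3
    have : 0 ≤ 2 ^ i.2 * (seminorm i x * seminorm i y) := by
      have : 0 ≤ seminorm i x := apply_nonneg _ _
      positivity
    exact h3.trans this
  · rw [show 2 ^ i.2 * (seminorm i x * seminorm i y) = (2 ^ i.2 * seminorm i y) * seminorm i x by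
      ring, ← div_le_iff₀' h0]
    refine le_projSeminorm P Q fun r hr => ?_
    rw [div_le_iff₀' h0]
    exact h2 r hr

theorem seminorm_star_le (i : ℕ × ℕ) (x : TensorAlg) : seminorm i (star x) ≤ seminorm i x := by
  refine le_projSeminorm _ _ ?_
  rintro _ ⟨n, a, b, rfl, rfl⟩
  refine le_trans (projSeminorm_le _ _ ⟨n, fun j => star (a j), fun j => star (b j), ?_, rfl⟩) ?_
  · rw [star_sum]; simp only [TensorProduct.star_tmul]
  · exact Finset.sum_le_sum fun j _ => mul_le_mul (maxKernelSeminorm_star_le _ _)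
      (maxDerivSeminorm_star_le _ _) (apply_nonneg _ _) (apply_nonneg _ _)

instance : UniformSpace TensorAlg := seminormUniformSpace seminorm

instance : IsUniformAddGroup TensorAlg := isUniformAddGroup_seminorm seminorm

theorem withSeminorms : WithSeminorms seminorm := withSeminorms_seminorm seminorm

instance : ContinuousSMul ℂ TensorAlg := withSeminorms.continuousSMul

instance : UniformContinuousConstSMul ℂ TensorAlg :=
  uniformContinuousConstSMul_of_continuousConstSMul ℂ _

instance : ContinuousMul TensorAlg := continuousMul_of_seminorms withSeminorms fun i =>
  ⟨_, _, _, withSeminorms.continuous_seminorm _, withSeminorms.continuous_seminorm _,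
    seminorm_mul_le i⟩

instance : ContinuousStar TensorAlg := continuousStar_of_seminorms withSeminorms fun i =>
  ⟨_, withSeminorms.continuous_seminorm _, seminorm_star_le i⟩

end TensorAlg

/-- The projective tensor product `K^∞ ⊗̂_γ C^∞(T)`: the completion of the algebraic tensor product
for the projective seminorms. -/
abbrev ProjTensor : Type := AlgCompletion TensorAlg

end SmoothCompacts

end

/-!
The gauge action is implemented by the unitaries `U_θ`, and although `U_θ` is not itself in `K^∞`,
it multiplies `K^∞`: the kernel function of `A U_θ ^ n` is `K_A (t, s - n θ)`, so right
multiplication by `U_θ ^ n` is a bijection of `K^∞` that preserves every seminorm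
(`kernelSeminorm_mulGauge`). Therefore the action can be untwisted by sending the formal sum
`∑ A_n U_θ ^ n` to `∑ (A_n U_θ ^ n) ⊗ t ^ n`, where now `A_n U_θ ^ n` is an operator
on the Hardy space. This is a `*`-homomorphism from `K^∞[ℤ]` to the algebraic tensor product
(`untwist_mul`, `untwist_star`).

It is a topological embedding. It is continuous because `‖t ^ n‖_M` grows polynomially in `n`
(`isBounded_untwist`). Conversely, the map that takes the `n`-th Fourier coefficient in the
second factor recovers `A_n U_θ ^ n`, and Fourier coefficients of smooth functions decay rapidly,
with bounds given by finitely many seminorms; so the seminorms of the crossed product are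
controlled by projective seminorms (`crossedSeminorm_le_seminorm_untwist`). Its range is dense
because Fourier series of smooth functions converge in `C^∞(T)` (`denseRange_untwist`). Hence the
projective tensor product is a completion of `K^∞[ℤ]`, and by uniqueness of completions it is
homeomorphic to the crossed product; the algebraic operations are respected by density.
-/

noncomputable section

open MeasureTheory AddCircle Filter Topology
open scoped TensorProduct

namespace SmoothCompacts

/-! ### Fourier series in `C^∞(T)` -/

/-- The function `t ↦ t ^ n` as an element of `C^∞(T)`. -/
def CInf.zpow (n : ℤ) : CInf := ⟨fun t => fourier n t, isSmooth1_fourier n⟩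

theorem CInf.zpow_add (m n : ℤ) : zpow (m + n) = zpow m * zpow n :=
  Subtype.ext (funext fun _ => fourier_add)

theorem CInf.star_zpow (n : ℤ) : star (zpow n) = zpow (-n) :=
  Subtype.ext (funext fun _ => fourier_neg.symm)

theorem CInf.deriv_zpow (n : ℤ) :
    (zpow n).deriv = (2 * Real.pi * Complex.I * n : ℂ) • zpow n :=
  Subtype.ext (circleDeriv_eq fun x => hasDerivAt_fourier' n x)

/-- Differentiation on `C^∞(T)` as a linear map. -/
def CInf.derivₗ : CInf →ₗ[ℂ] CInf where
  toFun := CInf.deriv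
  map_add' f g := Subtype.ext (circleDeriv_add f.isSmooth1 g.isSmooth1)
  map_smul' a f := Subtype.ext (circleDeriv_smul a f.isSmooth1)

theorem norm_two_pi_I_mul (n : ℤ) :
    ‖(2 * Real.pi * Complex.I * n : ℂ)‖ = 2 * Real.pi * |(n : ℝ)| := by
  simp only [norm_mul, Complex.norm_ofNat, Complex.norm_real, Complex.norm_I, Complex.norm_intCast,
    Real.norm_eq_abs, mul_one, abs_of_pos Real.pi_pos]

theorem derivSeminorm_zpow (k : ℕ) (n : ℤ) :
    derivSeminorm k (CInf.zpow n) = (2 * Real.pi * |(n : ℝ)|) ^ k := by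
  induction k with
  | zero =>
    change ⨆ t, ‖fourier n t‖ = _
    simp only [norm_fourier, ciSup_const, pow_zero]
  | succ k ih =>
    rw [← derivSeminorm_deriv, CInf.deriv_zpow, map_smul_eq_mul, ih, norm_two_pi_I_mul, pow_succ']

theorem maxDerivSeminorm_zpow_le (M : ℕ) (n : ℤ) :
    maxDerivSeminorm M (CInf.zpow n) ≤ (2 * Real.pi) ^ M * (1 + (|n| : ℝ) ^ 2) ^ M := by
  have h1 : 1 ≤ 2 * Real.pi := by linarith [Real.pi_gt_three]
  have h2 : |(n : ℝ)| ≤ 1 + (|n| : ℝ) ^ 2 := by nlinarith [sq_nonneg (|(n : ℝ)| - 1)]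
  have h3 : 1 ≤ 2 * Real.pi * (1 + (|n| : ℝ) ^ 2) := by
    nlinarith [sq_nonneg (|(n : ℝ)|)]
  rw [← mul_pow]
  refine Seminorm.finset_sup_apply_le (by positivity) fun k hk => ?_
  rw [derivSeminorm_zpow]
  calc (2 * Real.pi * |(n : ℝ)|) ^ k ≤ (2 * Real.pi * (1 + (|n| : ℝ) ^ 2)) ^ k := by gcongr
    _ ≤ (2 * Real.pi * (1 + (|n| : ℝ) ^ 2)) ^ M :=
      pow_le_pow_right₀ h3 (by have := Finset.mem_range.1 hk; omega)

/-- Rapid decay of Fourier coefficients, in terms of the weights of the crossed product. -/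
theorem weight_mul_norm_fourierCoeff_le (p : ℕ) (f : CInf) (n : ℤ) :
    (1 + (|n| : ℝ) ^ 2) ^ p * ‖fourierCoeff f.fn n‖ ≤
      2 ^ (p + 1) * maxDerivSeminorm (2 * p) f := by
  have h0 := pow_mul_norm_fourierCoeff_le f.isSmooth1 (norm_iterate_le f 0) n
  have h1 := pow_mul_norm_fourierCoeff_le f.isSmooth1 (norm_iterate_le f (2 * p)) n
  have m0 := derivSeminorm_le_max (Nat.zero_le (2 * p)) f
  have m1 := derivSeminorm_le_max (le_refl (2 * p)) f
  have hw : (1 + (|n| : ℝ) ^ 2) ^ p ≤ 2 ^ p * (1 + |(n : ℝ)| ^ (2 * p)) := by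
    have hx : 0 ≤ (|n| : ℝ) ^ 2 := by positivity
    rw [pow_mul]
    rcases le_total ((|n| : ℝ) ^ 2) 1 with h | h
    · calc (1 + (|n| : ℝ) ^ 2) ^ p ≤ 2 ^ p := by gcongr; linarith
        _ ≤ _ := le_mul_of_one_le_right (by positivity) (by
            simp only [le_add_iff_nonneg_right]
            positivity)
    · calc (1 + (|n| : ℝ) ^ 2) ^ p ≤ (2 * (|n| : ℝ) ^ 2) ^ p := by gcongr; linarith
        _ = 2 ^ p * ((|n| : ℝ) ^ 2) ^ p := mul_pow _ _ _
        _ ≤ _ := by gcongr; linarith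
  calc (1 + (|n| : ℝ) ^ 2) ^ p * ‖fourierCoeff f.fn n‖
      ≤ 2 ^ p * (1 + |(n : ℝ)| ^ (2 * p)) * ‖fourierCoeff f.fn n‖ := by gcongr
    _ = 2 ^ p * (|(n : ℝ)| ^ 0 * ‖fourierCoeff f.fn n‖ +
          |(n : ℝ)| ^ (2 * p) * ‖fourierCoeff f.fn n‖) := by ring
    _ ≤ 2 ^ p * (maxDerivSeminorm (2 * p) f + maxDerivSeminorm (2 * p) f) := by
        gcongr
        · exact h0.trans m0
        · exact h1.trans m1
    _ = _ := by ring

theorem CInf.summable_fourierCoeff (f : CInf) : Summable (fourierCoeff f.fn) := by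
  refine Summable.of_norm_bounded
    (CrossedAlg.summable_weight.mul_right (2 ^ 2 * maxDerivSeminorm 2 f)) fun n => ?_
  have := weight_mul_norm_fourierCoeff_le 1 f n
  rw [pow_one] at this
  rw [div_mul_eq_mul_div, one_mul, le_div_iff₀' (by positivity)]
  exact this

/-- The Fourier series of a smooth function converges in every seminorm of `C^∞(T)`: uniformly
because the coefficients are summable, and with all derivatives because differentiation commutes
with taking partial sums. -/
theorem tendsto_derivSeminorm_fourierSum (k : ℕ) (f : CInf) :
    Tendsto (fun s : Finset ℤ =>
      derivSeminorm k (∑ n ∈ s, fourierCoeff f.fn n • CInf.zpow n - f)) atTop (𝓝 0) := by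
  induction k generalizing f with
  | zero =>
    let g : C(Torus1, ℂ) := ⟨f.fn, f.isSmooth1.continuous⟩
    have h : HasSum (fun n => fourierCoeff f.fn n • (fourier n : C(Torus1, ℂ))) g :=
      hasSum_fourier_series_of_summable (f := g) f.summable_fourierCoeff
    refine squeeze_zero (fun s => apply_nonneg _ _) (fun s => ?_)
      (tendsto_iff_norm_sub_tendsto_zero.1 h)
    refine ciSup_le fun t => ?_
    refine le_trans (le_of_eq ?_) (ContinuousMap.norm_coe_le_norm
      (∑ n ∈ s, fourierCoeff f.fn n • (fourier n : C(Torus1, ℂ)) - g) t)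
    have e : (∑ n ∈ s, fourierCoeff f.fn n • CInf.zpow n - f : CInf).fn t =
        ∑ n ∈ s, fourierCoeff f.fn n * fourier n t - f.fn t := by
      let ev : CInf →ₗ[ℂ] ℂ := ⟨⟨fun f => f.fn t, fun _ _ => rfl⟩, fun _ _ => rfl⟩
      change ev (_ - _) = _
      rw [map_sub, map_sum]
      simp only [map_smul, smul_eq_mul]
      rfl
    simp only [Function.iterate_zero, id_eq]
    rw [e]
    simp [g]
  | succ k ih =>
    refine (ih f.deriv).congr fun s => ?_
    rw [← derivSeminorm_deriv]
    congr 1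
    change _ = CInf.derivₗ _
    rw [map_sub, map_sum]
    refine congrArg₂ _ (Finset.sum_congr rfl fun n _ => ?_) rfl
    rw [map_smul]
    change _ = fourierCoeff f.fn n • (CInf.zpow n).deriv
    rw [CInf.deriv_zpow, smul_smul]
    congr 1
    exact (fourierCoeff_circleDeriv f.isSmooth1 n).trans (mul_comm _ _)

theorem tendsto_maxDerivSeminorm_fourierSum (M : ℕ) (f : CInf) :
    Tendsto (fun s : Finset ℤ =>
      maxDerivSeminorm M (∑ n ∈ s, fourierCoeff f.fn n • CInf.zpow n - f)) atTop (𝓝 0) := by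
  have h := tendsto_finsetSum (Finset.range (M + 1)) fun k _ =>
    tendsto_derivSeminorm_fourierSum k f
  rw [Finset.sum_const_zero] at h
  refine squeeze_zero (fun s => apply_nonneg _ _) (fun s => ?_) h
  exact Seminorm.finset_sup_apply_le (Finset.sum_nonneg fun k _ => apply_nonneg _ _) fun k hk =>
    Finset.single_le_sum (f := fun k => derivSeminorm k _) (fun k _ => apply_nonneg _ _) hk

/-- The `n`-th Fourier coefficient as a linear functional on `C^∞(T)`. -/
def CInf.coeffₗ (n : ℤ) : CInf →ₗ[ℂ] ℂ where
  toFun f := fourierCoeff f.fn n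
  map_add' f g := congrFun (fourierCoeff.add
    (f.isSmooth1.continuous.integrable_of_hasCompactSupport (HasCompactSupport.of_compactSpace _))
    (g.isSmooth1.continuous.integrable_of_hasCompactSupport (HasCompactSupport.of_compactSpace _))) n
  map_smul' a f := fourierCoeff.const_smul f.fn a n

theorem CInf.coeffₗ_zpow (m n : ℤ) : CInf.coeffₗ n (zpow m) = if m = n then 1 else 0 := by
  have h := congrFun (fourierCoeff_fourier (T := 1) m) n
  rw [Pi.single_apply] at h
  simp only [eq_comm (a := m)]
  exact h

/-! ### Multiplication by powers of `U_θ` -/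

/-- Right multiplication `S ↦ S U_θ ^ n` on `K^∞`. -/
def mulGauge (θ : ℝ) (n : ℤ) : KInf →ₗ[ℂ] KInf where
  toFun S := ⟨S.op * (gaugeUnitary θ ^ n : unitary (H2 →L[ℂ] H2)), by
    refine isSmoothCompact_iff.2 (S.rapidDecay.of_le 0 1 fun i => ?_)
    rw [gaugeUnitary_zpow]
    change ‖inner ℂ (zpowH i.1) (S.op (rotH _ (zpowH i.2)))‖ ≤ _
    rw [rotH_zpowH, map_smul, inner_smul_right, norm_mul, norm_fourier]
    simp [matCoeff]⟩
  map_add' S R := KInf.ext_op (add_mul S.op R.op _)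
  map_smul' a S := KInf.ext_op (smul_mul_assoc a S.op _)

theorem op_mulGauge (θ : ℝ) (n : ℤ) (S : KInf) :
    (mulGauge θ n S).op = S.op * (gaugeUnitary θ ^ n : unitary (H2 →L[ℂ] H2)) := rfl

theorem op_gaugeAction (θ : ℝ) (n : ℤ) (S : KInf) :
    (gaugeAction θ n S).op = (gaugeUnitary θ ^ n : unitary (H2 →L[ℂ] H2)) * S.op *
      (gaugeUnitary θ ^ (-n) : unitary (H2 →L[ℂ] H2)) := by
  rw [zpow_neg]
  exact Unitary.conjStarAlgAut_apply _ _

theorem mulGauge_neg_cancel (θ : ℝ) (n : ℤ) (S : KInf) :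
    mulGauge θ n (mulGauge θ (-n) S) = S := by
  refine KInf.ext_op ?_
  rw [op_mulGauge, op_mulGauge, mul_assoc, ← Submonoid.coe_mul, ← _root_.zpow_add,
    neg_add_cancel, zpow_zero]
  exact mul_one _

/-- The covariance relation behind multiplicativity of the untwisting homomorphism:
`(A U_θ ^ m) (B U_θ ^ n) = A α_θ ^ m (B) U_θ ^ (m + n)` for composition of operators. -/
theorem mulGauge_mul (θ : ℝ) (m n : ℤ) (A B : KInf) :
    mulGauge θ m A * mulGauge θ n B = mulGauge θ (m + n) (A * gaugeAction θ m B) := by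
  refine KInf.ext_op ?_
  simp only [KInf.op_mul, op_mulGauge, op_gaugeAction, mul_assoc]
  rw [← Submonoid.coe_mul (unitary _) (gaugeUnitary θ ^ (-m)), ← _root_.zpow_add,
    neg_add_cancel_left]

theorem star_mulGauge (θ : ℝ) (n : ℤ) (A : KInf) :
    star (mulGauge θ n A) = mulGauge θ (-n) (gaugeAction θ (-n) (star A)) := by
  refine KInf.ext_op ?_
  simp only [KInf.op_star, op_mulGauge, op_gaugeAction, mul_assoc, neg_neg, star_mul]
  rw [← Submonoid.coe_mul (unitary _) (gaugeUnitary θ ^ n), ← _root_.zpow_add, add_neg_cancel,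
    zpow_zero, zpow_neg]
  exact congrArg (_ * ·) (mul_one (star A.op)).symm

/-- Multiplication by `U_θ ^ n` rotates the second variable of the kernel function, so that it
preserves each of the seminorms of `K^∞`. -/
theorem kernelSeminorm_mulGauge (θ : ℝ) (n : ℤ) (i : ℕ × ℕ) (S : KInf) :
    kernelSeminorm i (mulGauge θ n S) = kernelSeminorm i S := by
  set φ : ℝ := n • θ with hφ
  have hc : ∀ j : ℕ × ℕ, matCoeff (mulGauge θ n S).op j =
      fourier (-(j.2 : ℤ)) ((-φ : ℝ) : Torus1) * matCoeff S.op j := by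
    intro j
    rw [op_mulGauge, gaugeUnitary_zpow]
    change inner ℂ (zpowH j.1) (S.op (rotH φ (zpowH j.2))) = _
    rw [rotH_zpowH, map_smul, inner_smul_right, fourier_apply, fourier_apply, AddCircle.coe_neg,
      smul_neg, neg_smul, neg_neg]
    rfl
  rw [kernelSeminorm_eq, kernelSeminorm_eq,
    ← (Equiv.addRight ((0 : Torus1), ((-φ : ℝ) : Torus1))).iSup_comp
      (g := fun p => ‖kernelSeries (dMat i.1 i.2 (matCoeff S.op)) p‖)]
  congr 1
  funext p
  congr 1
  simp only [kernelSeries, Equiv.coe_addRight, Prod.fst_add, Prod.snd_add, add_zero]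
  refine tsum_congr fun j => ?_
  have h : ∀ (n : ℤ) (x y : Torus1), fourier n (x + y) = fourier n x * fourier n y := by
    intro n x y
    rw [fourier_apply, fourier_apply, fourier_apply, smul_add, AddCircle.toCircle_add]
    push_cast; rfl
  simp only [dMat, hc, h]
  ring

theorem maxKernelSeminorm_mulGauge (θ : ℝ) (n : ℤ) (N : ℕ) (S : KInf) :
    maxKernelSeminorm N (mulGauge θ n S) = maxKernelSeminorm N S := by
  rw [maxKernelSeminorm, Seminorm.finset_sup_apply, Seminorm.finset_sup_apply]
  congr 2
  funext i
  exact Subtype.ext (kernelSeminorm_mulGauge θ n i S)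

/-! ### The untwisting homomorphism on finite sums -/

/-- The linear map `∑ A_n U_θ ^ n ↦ ∑ (A_n U_θ ^ n) ⊗ t ^ n`, where on the right `A_n U_θ ^ n` is
the composition of operators on the Hardy space. -/
def untwist (θ : ℝ) : CrossedAlg θ →ₗ[ℂ] TensorAlg :=
  (Finsupp.lsum ℂ fun n : ℤ =>
    ((TensorProduct.mk ℂ KInf CInf).flip (CInf.zpow n)).comp (mulGauge θ n) :
      (ℤ →₀ KInf) →ₗ[ℂ] TensorAlg)

theorem untwist_eq_sum (θ : ℝ) (x : CrossedAlg θ) :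
    untwist θ x = x.coeffs.sum fun n A => mulGauge θ n A ⊗ₜ[ℂ] CInf.zpow n := rfl

/-- The element `A U_θ ^ n` of `K^∞[ℤ]`. -/
def CrossedAlg.single (θ : ℝ) (n : ℤ) (A : KInf) : CrossedAlg θ := Finsupp.single n A

theorem CrossedAlg.single_mul_single (θ : ℝ) (m n : ℤ) (A B : KInf) :
    single θ m A * single θ n B = single θ (m + n) (A * gaugeAction θ m B) :=
  crossMul_single θ m n A B

theorem CrossedAlg.star_single (θ : ℝ) (n : ℤ) (A : KInf) :
    star (single θ n A) = single θ (-n) (gaugeAction θ (-n) (star A)) :=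
  crossStar_single θ n A

theorem CrossedAlg.induction_linear {θ : ℝ} {P : CrossedAlg θ → Prop} (x : CrossedAlg θ)
    (zero : P 0) (add : ∀ x y, P x → P y → P (x + y)) (single : ∀ n A, P (single θ n A)) : P x :=
  Finsupp.induction_linear (motive := fun x : ℤ →₀ KInf => P x) x zero add single

theorem untwist_single (θ : ℝ) (n : ℤ) (A : KInf) :
    untwist θ (CrossedAlg.single θ n A) = mulGauge θ n A ⊗ₜ[ℂ] CInf.zpow n := by
  refine (untwist_eq_sum θ _).trans (Finsupp.sum_single_index ?_)
  rw [map_zero, TensorProduct.zero_tmul]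

theorem untwist_mul (θ : ℝ) (x y : CrossedAlg θ) :
    untwist θ (x * y) = untwist θ x * untwist θ y := by
  induction x using CrossedAlg.induction_linear with
  | zero => rw [zero_mul, map_zero, zero_mul]
  | add f g hf hg => rw [add_mul, map_add, hf, hg, map_add, add_mul]
  | single m A =>
    induction y using CrossedAlg.induction_linear with
    | zero => rw [mul_zero, map_zero, mul_zero]
    | add f g hf hg => rw [mul_add, map_add, hf, hg, map_add, mul_add]
    | single n B =>
      rw [CrossedAlg.single_mul_single, untwist_single, untwist_single, untwist_single,
        Algebra.TensorProduct.tmul_mul_tmul, mulGauge_mul, CInf.zpow_add]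

theorem untwist_star (θ : ℝ) (x : CrossedAlg θ) : untwist θ (star x) = star (untwist θ x) := by
  induction x using CrossedAlg.induction_linear with
  | zero => rw [star_zero, map_zero, star_zero]
  | add f g hf hg => rw [star_add, map_add, hf, hg, map_add, star_add]
  | single n A =>
    rw [CrossedAlg.star_single, untwist_single, untwist_single, TensorProduct.star_tmul,
      star_mulGauge, CInf.star_zpow]

/-! ### Estimates for the untwisting homomorphism -/

/-- Continuity of the untwisting homomorphism: each term contributes at most
`‖A_n‖_N ‖t ^ n‖_M`, and the powers of `n` are absorbed by the weights of the crossed product. -/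
theorem isBounded_untwist (θ : ℝ) :
    Seminorm.IsBounded (CrossedAlg.crossedSeminorm θ) TensorAlg.seminorm (untwist θ) := by
  refine .of_real fun ⟨N, M⟩ => ?_
  -- `maxDerivSeminorm M (t ^ n)` grows like `(1 + n ^ 2) ^ M`; one more power of the weight makes
  -- the sum over `n` converge.
  set s : Finset (ℕ × ℕ × ℕ) := {M + 1} ×ˢ (Finset.range (N + 1) ×ˢ Finset.range (N + 1)) with hs
  refine ⟨s, (2 * Real.pi) ^ M * ∑' n : ℤ, 1 / (1 + (|n| : ℝ) ^ 2), fun x => ?_⟩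
  set Q := s.sup (CrossedAlg.crossedSeminorm θ) x with hQ
  have hQ0 : 0 ≤ Q := apply_nonneg _ _
  have hx : ∀ n : ℤ, (1 + (|n| : ℝ) ^ 2) ^ (M + 1) * maxKernelSeminorm N (x.coeffs n) ≤ Q := by
    intro n
    rw [← le_div_iff₀' (by positivity)]
    refine maxKernelSeminorm_le (by positivity) fun l m hl hm => ?_
    rw [le_div_iff₀' (by positivity)]
    exact (CrossedAlg.le_crossedSeminorm θ (M + 1) (l, m) x n).trans
      (Seminorm.le_finset_sup_apply (p := CrossedAlg.crossedSeminorm θ) (i := (M + 1, l, m))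
        (by
          simp only [hs, Finset.mem_product, Finset.mem_singleton, Finset.mem_range]
          exact ⟨trivial, by omega, by omega⟩))
  have hterm : ∀ n : ℤ, TensorAlg.seminorm (N, M) (mulGauge θ n (x.coeffs n) ⊗ₜ CInf.zpow n) ≤
      (2 * Real.pi) ^ M * Q * (1 / (1 + (|n| : ℝ) ^ 2)) := by
    intro n
    refine (projSeminorm_le _ _ (projValues_tmul _ _ _ _)).trans ?_
    rw [maxKernelSeminorm_mulGauge, mul_one_div, le_div_iff₀ (by positivity)]
    have h1 := maxDerivSeminorm_zpow_le M n
    have h2 : 0 ≤ maxKernelSeminorm N (x.coeffs n) := apply_nonneg _ _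
    calc maxKernelSeminorm N (x.coeffs n) * maxDerivSeminorm M (CInf.zpow n) *
          (1 + (|n| : ℝ) ^ 2)
        ≤ maxKernelSeminorm N (x.coeffs n) *
            ((2 * Real.pi) ^ M * (1 + (|n| : ℝ) ^ 2) ^ M) * (1 + (|n| : ℝ) ^ 2) := by gcongr
      _ = (2 * Real.pi) ^ M *
            ((1 + (|n| : ℝ) ^ 2) ^ (M + 1) * maxKernelSeminorm N (x.coeffs n)) := by ring
      _ ≤ _ := by gcongr; exact hx n
  rw [untwist_eq_sum]
  refine (Finset.le_sum_of_subadditive _ (map_zero _).le (map_add_le_add _) _ _).trans ?_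
  refine (Finset.sum_le_sum fun n _ => hterm n).trans ?_
  rw [← Finset.mul_sum, mul_right_comm]
  gcongr
  exact CrossedAlg.summable_weight.sum_le_tsum _ fun n _ => by positivity

/-- The linear map `a ⊗ f ↦ c_n (f) a`, where `c_n (f)` is the `n`-th Fourier coefficient of `f`. -/
def TensorAlg.coeffₗ (n : ℤ) : TensorAlg →ₗ[ℂ] KInf :=
  (TensorProduct.rid ℂ KInf).toLinearMap ∘ₗ TensorProduct.map LinearMap.id (CInf.coeffₗ n)

theorem TensorAlg.coeffₗ_tmul (n : ℤ) (a : KInf) (f : CInf) :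
    coeffₗ n (a ⊗ₜ[ℂ] f) = CInf.coeffₗ n f • a := by
  simp [coeffₗ]

theorem TensorAlg.coeffₗ_untwist (θ : ℝ) (n : ℤ) (x : CrossedAlg θ) :
    coeffₗ n (untwist θ x) = mulGauge θ n (x.coeffs n) := by
  induction x using CrossedAlg.induction_linear with
  | zero => rw [map_zero, map_zero]; exact (map_zero _).symm
  | add x y hx hy => rw [map_add, map_add, hx, hy, ← map_add]; rfl
  | single m A =>
    rw [untwist_single, coeffₗ_tmul, CInf.coeffₗ_zpow]
    change _ = mulGauge θ n ((Finsupp.single m A : ℤ →₀ KInf) n)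
    rw [Finsupp.single_apply]
    split_ifs with h
    · rw [one_smul, h]
    · rw [zero_smul, map_zero]

/-- The Fourier coefficients of a smooth function decay rapidly, hence so do the coefficients of an
element of the tensor product, uniformly with respect to the projective seminorms. -/
theorem weight_mul_kernelSeminorm_coeffₗ_le (p : ℕ) {l m N : ℕ} (hl : l ≤ N) (hm : m ≤ N) (n : ℤ)
    (x : TensorAlg) :
    (1 + (|n| : ℝ) ^ 2) ^ p * kernelSeminorm (l, m) (TensorAlg.coeffₗ n x) ≤
      2 ^ (p + 1) * TensorAlg.seminorm (N, 2 * p) x := by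
  rw [← div_le_iff₀' (by positivity)]
  refine le_projSeminorm _ _ ?_
  rintro _ ⟨k, a, b, rfl, rfl⟩
  rw [div_le_iff₀' (by positivity), map_sum]
  have h := Finset.le_sum_of_subadditive (kernelSeminorm (l, m)) (map_zero _).le
    (map_add_le_add _) Finset.univ fun j => TensorAlg.coeffₗ n (a j ⊗ₜ[ℂ] b j)
  refine (mul_le_mul_of_nonneg_left h (by positivity)).trans ?_
  rw [Finset.mul_sum, Finset.mul_sum]
  refine Finset.sum_le_sum fun j _ => ?_
  rw [TensorAlg.coeffₗ_tmul, map_smul_eq_mul]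
  have h1 := weight_mul_norm_fourierCoeff_le p (b j) n
  have h2 := kernelSeminorm_le_max hl hm (a j)
  calc (1 + (|n| : ℝ) ^ 2) ^ p * (‖CInf.coeffₗ n (b j)‖ * kernelSeminorm (l, m) (a j))
      = (1 + (|n| : ℝ) ^ 2) ^ p * ‖fourierCoeff (b j).fn n‖ * kernelSeminorm (l, m) (a j) :=
        (mul_assoc _ _ _).symm
    _ ≤ 2 ^ (p + 1) * maxDerivSeminorm (2 * p) (b j) * maxKernelSeminorm N (a j) :=
        mul_le_mul h1 h2 (apply_nonneg _ _) ((by positivity : (0 : ℝ) ≤ _).trans h1)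
    _ = _ := by ring

/-- The untwisting homomorphism is bounded below, since its coefficients recover `A_n U_θ ^ n`. -/
theorem crossedSeminorm_le_seminorm_untwist (θ : ℝ) (p l m : ℕ) (x : CrossedAlg θ) :
    CrossedAlg.crossedSeminorm θ (p, l, m) x ≤
      2 ^ (p + 1) * TensorAlg.seminorm (max l m, 2 * p) (untwist θ x) := by
  refine ciSup_le fun n => ?_
  have h := weight_mul_kernelSeminorm_coeffₗ_le p (le_max_left l m) (le_max_right l m) n
    (untwist θ x)
  rwa [TensorAlg.coeffₗ_untwist, kernelSeminorm_mulGauge] at h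

theorem isUniformInducing_untwist (θ : ℝ) : IsUniformInducing (untwist θ) := by
  refine AddMonoidHom.isUniformInducing_of_isInducing ⟨?_⟩
  have h : WithSeminorms (topology := .induced (untwist θ) inferInstance)
      (CrossedAlg.crossedSeminorm θ) := by
    let _ : TopologicalSpace (CrossedAlg θ) := .induced (untwist θ) inferInstance
    refine WithSeminorms.congr
      (LinearMap.withSeminorms_induced TensorAlg.withSeminorms (untwist θ)) ?_ ?_
    · refine .of_real fun ⟨p, l, m⟩ => ⟨{(max l m, 2 * p)}, 2 ^ (p + 1), fun x => ?_⟩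
      rw [Finset.sup_singleton]
      exact crossedSeminorm_le_seminorm_untwist θ p l m x
    · exact isBounded_untwist θ
  rw [(CrossedAlg.withSeminorms θ).topology_eq_withSeminorms]
  exact (WithSeminorms.topology_eq_withSeminorms
    (topology := .induced (untwist θ) inferInstance) h).symm

/-- The range contains every `a ⊗ t ^ n`, namely as the image of `(a U_θ ^ (-n)) U_θ ^ n`, and the
partial sums of the Fourier series of `f` approximate `a ⊗ f`. -/
theorem denseRange_untwist (θ : ℝ) : DenseRange (untwist θ) := by
  have h : (⊤ : Submodule ℂ TensorAlg) ≤ (LinearMap.range (untwist θ)).topologicalClosure := by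
    rw [← TensorProduct.span_tmul_eq_top, Submodule.span_le]
    rintro _ ⟨a, f, rfl⟩
    have ht : Tendsto (fun s : Finset ℤ =>
        a ⊗ₜ[ℂ] (∑ n ∈ s, fourierCoeff f.fn n • CInf.zpow n)) atTop (𝓝 (a ⊗ₜ[ℂ] f)) := by
      rw [TensorAlg.withSeminorms.tendsto_nhds]
      rintro ⟨N, M⟩ ε hε
      have h0 := (tendsto_maxDerivSeminorm_fourierSum M f).const_mul (maxKernelSeminorm N a)
      rw [mul_zero] at h0
      filter_upwards [h0.eventually_lt_const hε] with s hs
      rw [← TensorProduct.tmul_sub]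
      exact (projSeminorm_le _ _ (projValues_tmul _ _ _ _)).trans_lt hs
    refine mem_closure_of_tendsto ht (Eventually.of_forall fun s => ?_)
    rw [TensorProduct.tmul_sum]
    refine Submodule.sum_mem _ fun n _ => ?_
    rw [TensorProduct.tmul_smul]
    refine Submodule.smul_mem _ _
      ⟨CrossedAlg.single θ n (mulGauge θ (-n) a), ?_⟩
    rw [untwist_single, mulGauge_neg_cancel]
  exact fun x => h trivial

/-! ### Passage to the completions -/

/-- The completion of a topological `*`-algebra as an abstract completion. -/
def AlgCompletion.pkg (A : Type) [NonUnitalRing A] [UniformSpace A] [IsUniformAddGroup A] :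
    AbstractCompletion.{0, 0} A where
  space := AlgCompletion A
  coe := AlgCompletion.of
  uniformStruct := inferInstance
  complete := inferInstance
  separation := inferInstance
  isUniformInducing := UniformSpace.Completion.isUniformInducing_coe A
  dense := AlgCompletion.denseRange_of

/-- As the untwisting homomorphism induces the topology and has dense range, it makes the
projective tensor product a completion of `K^∞[ℤ]`. -/
def untwistPkg (θ : ℝ) : AbstractCompletion.{0, 0} (CrossedAlg θ) where
  space := ProjTensor
  coe x := AlgCompletion.of (untwist θ x)
  uniformStruct := inferInstance
  complete := inferInstance
  separation := inferInstance
  isUniformInducing := (UniformSpace.Completion.isUniformInducing_coe TensorAlg).comp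
    (isUniformInducing_untwist θ)
  dense := AlgCompletion.denseRange_of.comp (denseRange_untwist θ) AlgCompletion.continuous_of

/-- The homeomorphism of the completions that extends the untwisting homomorphism. -/
def untwistCompletion (θ : ℝ) : CrossedProduct θ ≃ᵤ ProjTensor :=
  (AlgCompletion.pkg (CrossedAlg θ)).compareEquiv (untwistPkg θ)

theorem untwistCompletion_of (θ : ℝ) (x : CrossedAlg θ) :
    untwistCompletion θ (AlgCompletion.of x) = AlgCompletion.of (untwist θ x) :=
  (AlgCompletion.pkg (CrossedAlg θ)).compare_coe (untwistPkg θ) x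

@[fun_prop]
theorem continuous_untwistCompletion (θ : ℝ) : Continuous (untwistCompletion θ) :=
  (untwistCompletion θ).continuous

/-- The isomorphism of the crossed product with the projective tensor product. -/
def untwistEquiv (θ : ℝ) : CrossedProduct θ ≃⋆ₐ[ℂ] ProjTensor where
  toEquiv := (untwistCompletion θ).toEquiv
  map_add' x y := AlgCompletion.induction₃
    (P := fun x y _ => untwistCompletion θ (x + y) = untwistCompletion θ x + untwistCompletion θ y)
    (isClosed_eq (by fun_prop) (by fun_prop)) (fun a b _ => by
      rw [← map_add, untwistCompletion_of, untwistCompletion_of, untwistCompletion_of, map_add,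
        map_add]) x y 0
  map_mul' x y := AlgCompletion.induction₃
    (P := fun x y _ => untwistCompletion θ (x * y) = untwistCompletion θ x * untwistCompletion θ y)
    (isClosed_eq (by fun_prop) (by fun_prop)) (fun a b _ => by
      rw [← AlgCompletion.of_mul, untwistCompletion_of, untwistCompletion_of,
        untwistCompletion_of, untwist_mul, AlgCompletion.of_mul]) x y 0
  map_star' x := AlgCompletion.induction₁
    (P := fun x => untwistCompletion θ (star x) = star (untwistCompletion θ x))
    (isClosed_eq (by fun_prop) (by fun_prop)) (fun a => by
      rw [← AlgCompletion.of_star, untwistCompletion_of, untwistCompletion_of, untwist_star,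
        AlgCompletion.of_star]) x
  map_smul' c x := AlgCompletion.induction₁
    (P := fun x => untwistCompletion θ (c • x) = c • untwistCompletion θ x)
    (isClosed_eq ((continuous_untwistCompletion θ).comp (continuous_const_smul c))
      ((continuous_untwistCompletion θ).const_smul c)) (fun a => by
      rw [← AlgCompletion.of_smul, untwistCompletion_of, untwistCompletion_of, map_smul,
        AlgCompletion.of_smul]) x

end SmoothCompacts

end

theorem mainTheorem5 (θ : ℝ) :
    ∃ Φ : SmoothCompacts.CrossedProduct θ ≃⋆ₐ[ℂ] SmoothCompacts.ProjTensor,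
      Continuous Φ ∧ Continuous Φ.symm :=
  ⟨SmoothCompacts.untwistEquiv θ, (SmoothCompacts.untwistCompletion θ).continuous,
    (SmoothCompacts.untwistCompletion θ).symm.continuous⟩
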